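/- Let $\mathcal A$ be a complex Hopf *-algebra (for instance the polynomial functions on a compact matrix quantum group $G$) and $\Gamma$ a bicovariant first-order *-calculus over it, with left-invariant part $\Gamma_{inv}$, adjoint action $\varpi\colon\Gamma_{inv}\to\Gamma_{inv}\otimes\mathcal A$, and universal differential envelope $\Gamma^\wedge=\Gamma^\otimes/S^\wedge$, where $S^\wedge$ is the ideal generated by the elements $\sum_k da_k\,db_k$ with $\sum_k a_k\,db_k=0$. In all graded-differential *-algebras $d$ commutes with $*$ and $(xy)^*=(-1)^{\partial x\partial y}y^*x^*$. Let $P=(\mathcal B,i,F)$ be a quantum principal $G$-bundle over a quantum space $M$, and let $\Omega(P)$ be a graded-differential *-algebra generated by $\Omega^0(P)=\mathcal B$ as a differential algebra, such that $F$ extends to a homomorphism of graded-differential *-algebras $\widehat F\colon\Omega(P)\to\Omega(P)\mathbin{\widehat\otimes}\Gamma^\wedge$. Put $F^\wedge=(\mathrm{id}\otimes p_*)\widehat F$ with $p_*\colon\Gamma^\wedge\to\mathcal A$ the projection onto degree $0$, $\mathrm{hor}(P)=\widehat F^{-1}(\Omega(P)\otimes\mathcal A)$, $\Omega(M)=\{x\in\Omega(P):\widehat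 F(x)=x\otimes1\}$, and let $H(M)$ be the cohomology algebra of $(\Omega(M),d)$ with the involution $[x]^*=[x^*]$. A connection is a linear map $\omega\colon\Gamma_{inv}\to\Omega^1(P)$ with $\omega(\vartheta^*)=\omega(\vartheta)^*$ and $\widehat F\omega(\vartheta)=\sum_k\omega(\vartheta_k)\otimes c_k+1\otimes\vartheta$, where $\varpi(\vartheta)=\sum_k\vartheta_k\otimes c_k$. A pseudotensorial $n$-form is a linear map $\varphi\colon\Gamma_{inv}\to\Omega^n(P)$ with $F^\wedge\varphi=(\varphi\otimes\mathrm{id})\varpi$; write $\partial\varphi=n$. Let $\delta\colon\Gamma_{inv}\to\Gamma_{inv}\otimes\Gamma_{inv}$ be an embedded differential: a linear map that intertwines the adjoint actions, is hermitian for $(\vartheta\otimes\eta)^*=-\eta^*\otimes\vartheta^*$, and satisfies $d\vartheta=\sum\vartheta^1\vartheta^2$ in $\Gamma^\wedge$ whenever $\delta(\vartheta)=\sum\vartheta^1\otimes\vartheta^2$. Put $\langle\varphi,\psi\rangle(\vartheta)=\sum\varphi(\vartheta^1)\psi(\vartheta^2)$ and $R_\omega=d\omega-\langle\omega,\omega\rangle$,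 and let $R_\omega^\otimes\colon\Gamma_{inv}^\otimes\to\Omega(P)$ be the unital multiplicative extension of $R_\omega$ to the tensor algebra of $\Gamma_{inv}$. Let $\mathcal K_\omega\subseteq\Omega(P)$ be the two-sided ideal generated by the elements $\langle\omega,\varphi\rangle(\vartheta)-(-1)^{\partial\varphi}\langle\varphi,\omega\rangle(\vartheta)$, for all pseudotensorial forms $\varphi$ and all $\vartheta\in\Gamma_{inv}$. Let $I^\star\subseteq\Gamma_{inv}^\otimes$ be the algebra of elements invariant under the adjoint action, with the involution $(\vartheta_1\otimes\cdots\otimes\vartheta_n)^*=\vartheta_n^*\otimes\cdots\otimes\vartheta_1^*$, and put $W^\omega(\vartheta)=R_\omega^\otimes(\vartheta)$ for $\vartheta\in I^\star$. Suppose that $\mathcal X$ is a (non-empty) real affine space of connections such that $\mathrm{hor}(P)\cap\mathcal K_\omega=\{0\}$ for every $\omega\in\mathcal X$. Then: (i) for each $\omega\in\mathcal X$ and $\vartheta\in I^\star$, the form $W^\omega(\vartheta)$ belongs to $\Omega(M)$ and is closed; (ii) the cohomology class of $W^\omega(\vartheta)$ in $\Omega(M)$ does not depend on $\omega\in\mathcal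 X$, the space $I^\star$ is closed under the involution, and the resulting map $W\colon I^\star\to H(M)$, $W(\vartheta)=[W^\omega(\vartheta)]$, is a unital *-homomorphism. -/

import Mathlib

open scoped TensorProduct
open MulOpposite

namespace QuantumBundle


noncomputable section

/-- A Hopf *-algebra: a complex Hopf algebra which is a *-algebra such that the coproduct is a
*-homomorphism, where `A ⊗ A` carries the *-structure `(a ⊗ b)* = a* ⊗ b*`. -/
class HopfStarAlgebra (A : Type*) [Ring A] [HopfAlgebra ℂ A] [StarRing A] [StarModule ℂ A] :
    Prop where
  comul_star : ∀ a : A, (Coalgebra.comul (R := ℂ) (star a) : A ⊗[ℂ] A) =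
    star (Coalgebra.comul (R := ℂ) a)

section Bimodule

variable (A Γ : Type*) [Ring A] [Algebra ℂ A] [AddCommGroup Γ] [Module ℂ Γ] [Module A Γ]
  [IsScalarTower ℂ A Γ]

/-- The left module structure as a bilinear map. -/
def lAct : A →ₗ[ℂ] Γ →ₗ[ℂ] Γ := (Algebra.lsmul ℂ ℂ Γ : A →ₐ[ℂ] Module.End ℂ Γ).toLinearMap

/-- `(a ⊗ b) · (c ⊗ ξ) = a c ⊗ b ξ`. -/
def actR : A ⊗[ℂ] A →ₗ[ℂ] A ⊗[ℂ] Γ →ₗ[ℂ] A ⊗[ℂ] Γ :=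
  TensorProduct.map₂ (LinearMap.mul ℂ A) (lAct A Γ)

/-- `(a ⊗ b) · (ξ ⊗ c) = a ξ ⊗ b c`. -/
def actL : A ⊗[ℂ] A →ₗ[ℂ] Γ ⊗[ℂ] A →ₗ[ℂ] Γ ⊗[ℂ] A :=
  TensorProduct.map₂ (lAct A Γ) (LinearMap.mul ℂ A)

variable {A Γ}

@[simp] lemma lAct_apply (a : A) (ξ : Γ) : lAct A Γ a ξ = a • ξ := rfl

@[simp] lemma actR_tmul (a b c : A) (ξ : Γ) :
    actR A Γ (a ⊗ₜ b) (c ⊗ₜ ξ) = (a * c) ⊗ₜ (b • ξ) := rfl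

@[simp] lemma actL_tmul (a b c : A) (ξ : Γ) :
    actL A Γ (a ⊗ₜ b) (ξ ⊗ₜ c) = (a • ξ) ⊗ₜ (b * c) := rfl

end Bimodule

/-- A bicovariant first-order *-calculus over the quantum group represented by `A`: an `A`-bimodule
`Γ` with a derivation `d : A → Γ` such that `Γ` is spanned by the elements `a d(b)`, such that the
left and right actions of the quantum group on `Γ`,
`a d(b) ↦ φ(a) (id ⊗ d)(φ(b))` and `a d(b) ↦ φ(a) (d ⊗ id)(φ(b))`, are well defined, and such that
the antilinear involution of `Γ` satisfies `(a d(b))* = d(b*) a*`. -/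
structure BicovariantCalculus (A Γ : Type*) [Ring A] [HopfAlgebra ℂ A] [StarRing A]
    [StarModule ℂ A] [AddCommGroup Γ] [Module ℂ Γ] [Module A Γ] [Module Aᵐᵒᵖ Γ]
    [IsScalarTower ℂ A Γ] [IsScalarTower ℂ Aᵐᵒᵖ Γ] [SMulCommClass A Aᵐᵒᵖ Γ]
    [StarAddMonoid Γ] [StarModule ℂ Γ] where
  d : A →ₗ[ℂ] Γ
  leibniz : ∀ a b : A, d (a * b) = a • d b + op b • d a
  spanned : ∀ ξ : Γ, ξ ∈ Submodule.span ℂ {η : Γ | ∃ a b : A, η = a • d b}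
  leftAction : Γ →ₗ[ℂ] A ⊗[ℂ] Γ
  leftAction_smul_d : ∀ a b : A, leftAction (a • d b) =
    actR A Γ (Coalgebra.comul a) (d.lTensor A (Coalgebra.comul b))
  rightAction : Γ →ₗ[ℂ] Γ ⊗[ℂ] A
  rightAction_smul_d : ∀ a b : A, rightAction (a • d b) =
    actL A Γ (Coalgebra.comul a) (d.rTensor A (Coalgebra.comul b))
  star_smul_d : ∀ a b : A, star (a • d b) = op (star a) • d (star b)

namespace BicovariantCalculus

variable {A Γ : Type*} [Ring A] [HopfAlgebra ℂ A] [StarRing A] [StarModule ℂ A]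
  [AddCommGroup Γ] [Module ℂ Γ] [Module A Γ] [Module Aᵐᵒᵖ Γ]
  [IsScalarTower ℂ A Γ] [IsScalarTower ℂ Aᵐᵒᵖ Γ] [SMulCommClass A Aᵐᵒᵖ Γ]
  [StarAddMonoid Γ] [StarModule ℂ Γ] (C : BicovariantCalculus A Γ)

/-- The linear map `a ⊗ b ↦ a d(b)`. -/
def adb : A ⊗[ℂ] A →ₗ[ℂ] Γ := TensorProduct.lift ((lAct A Γ).compl₂ C.d)

@[simp] lemma adb_tmul (a b : A) : C.adb (a ⊗ₜ b) = a • C.d b := rfl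

lemma adb_surjective : Function.Surjective C.adb := by
  rw [← LinearMap.range_eq_top, eq_top_iff]
  intro ξ _
  refine (Submodule.span_le.2 ?_) (C.spanned ξ)
  rintro _ ⟨a, b, rfl⟩
  exact ⟨a ⊗ₜ b, rfl⟩

theorem induction {p : Γ → Prop} (h : ∀ a b : A, p (a • C.d b))
    (hadd : ∀ x y, p x → p y → p (x + y)) (ξ : Γ) : p ξ := by
  obtain ⟨t, rfl⟩ := C.adb_surjective ξ
  induction t with
  | zero => simpa using h 0 0
  | tmul a b => exact h a b
  | add x y hx hy => rw [map_add]; exact hadd _ _ hx hy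

lemma d_one : C.d 1 = 0 := by
  have h := C.leibniz 1 1
  simpa using h

lemma star_d (a : A) : star (C.d a) = C.d (star a) := by
  have h := C.star_smul_d 1 a
  simpa using h

lemma star_smul (C : BicovariantCalculus A Γ) (a : A) (ξ : Γ) : star (a • ξ) = op (star a) • star ξ := by
  induction ξ using C.induction with
  | h b c => rw [← mul_smul, C.star_smul_d, C.star_smul_d, star_mul, op_mul, mul_smul]
  | hadd x y hx hy => simp only [smul_add, star_add, hx, hy]

lemma star_op_smul (C : BicovariantCalculus A Γ) (a : A) (ξ : Γ) : star (op a • ξ) = star a • star ξ := by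
  have h := C.star_smul (star a) (star ξ)
  rw [star_star, star_star] at h
  rw [← h, star_star]

/-- The left-invariant part of the calculus. -/
def inv : Submodule ℂ Γ where
  carrier := {ξ | C.leftAction ξ = 1 ⊗ₜ ξ}
  add_mem' {x y} hx hy := by
    simp only [Set.mem_ofPred_eq] at hx hy ⊢
    rw [map_add, hx, hy, TensorProduct.tmul_add]
  zero_mem' := by simp
  smul_mem' z x hx := by
    simp only [Set.mem_ofPred_eq] at hx ⊢
    rw [map_smul, hx, TensorProduct.tmul_smul]

lemma mem_inv {ξ : Γ} : ξ ∈ C.inv ↔ C.leftAction ξ = 1 ⊗ₜ ξ := Iff.rfl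

section Star

variable [HopfStarAlgebra A]

lemma star_actR_aux (X Y : A ⊗[ℂ] A) :
    star (actR A Γ X (C.d.lTensor A Y)) =
      C.d.lTensor A (star Y * star X) - actR A Γ (star Y) (C.d.lTensor A (star X)) := by
  induction X with
  | zero => simp
  | add X X' h h' =>
    simp only [map_add, LinearMap.add_apply, star_add, h, h', mul_add]; abel
  | tmul x x' =>
    induction Y with
    | zero => simp
    | add Y Y' h h' =>
      simp only [map_add, LinearMap.add_apply, star_add, h, h', add_mul]; abel
    | tmul y y' =>
      simp only [LinearMap.lTensor_tmul, actR_tmul, TensorProduct.star_tmul,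
        Algebra.TensorProduct.tmul_mul_tmul, ← TensorProduct.tmul_sub, C.leibniz, C.star_smul_d,
        star_mul, add_sub_cancel_left]

lemma leftAction_star (ξ : Γ) : C.leftAction (star ξ) = star (C.leftAction ξ) := by
  induction ξ using C.induction with
  | hadd x y hx hy => simp only [star_add, map_add, hx, hy]
  | h a b =>
    have h1 : star (a • C.d b) = (1 : A) • C.d (star b * star a) - star b • C.d (star a) := by
      rw [C.star_smul_d, C.leibniz, one_smul, add_sub_cancel_left]
    rw [h1, map_sub, C.leftAction_smul_d, C.leftAction_smul_d, C.leftAction_smul_d,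
      C.star_actR_aux, Bialgebra.comul_mul, HopfStarAlgebra.comul_star,
      HopfStarAlgebra.comul_star, Bialgebra.comul_one]
    congr 1
    generalize C.d.lTensor A _ = Z
    induction Z with
    | zero => simp
    | add Z Z' h h' => simp only [map_add, h, h']
    | tmul z ζ => rw [Algebra.TensorProduct.one_def, actR_tmul, one_mul, one_smul]

/-- The antilinear involution of the left-invariant part. -/
instance : StarAddMonoid C.inv where
  star x := ⟨star x.1, by
    have h := x.2
    rw [mem_inv] at h ⊢
    rw [C.leftAction_star, h, TensorProduct.star_tmul, star_one]⟩
  star_involutive x := Subtype.ext (star_star x.1)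
  star_add x y := Subtype.ext (star_add x.1 y.1)

@[simp] lemma coe_star_inv (x : C.inv) : ((star x : C.inv) : Γ) = star (x : Γ) := rfl

instance : StarModule ℂ C.inv where
  star_smul z x := Subtype.ext (StarModule.star_smul z x.1)

end Star

lemma coaction_auxL (X Y : A ⊗[ℂ] A) :
    C.leftAction.rTensor A (actL A Γ X (C.d.rTensor A Y)) =
      (TensorProduct.assoc ℂ A Γ A).symm
        (TensorProduct.map₂ (LinearMap.mul ℂ A) (actL A Γ)
          (TensorProduct.assoc ℂ A A A ((Coalgebra.comul (R := ℂ) (A := A)).rTensor A X))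
          ((C.d.rTensor A).lTensor A
            (TensorProduct.assoc ℂ A A A ((Coalgebra.comul (R := ℂ) (A := A)).rTensor A Y)))) := by
  induction X with
  | zero => simp
  | add X X' h h' => simp only [map_add, LinearMap.add_apply, h, h']
  | tmul x x' =>
    induction Y with
    | zero => simp
    | add Y Y' h h' => simp only [map_add, h, h']
    | tmul y y' =>
      simp only [LinearMap.rTensor_tmul, actL_tmul, C.leftAction_smul_d]
      generalize (Coalgebra.comul (R := ℂ) x : A ⊗[ℂ] A) = X
      generalize (Coalgebra.comul (R := ℂ) y : A ⊗[ℂ] A) = Y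
      induction X with
      | zero => simp
      | add X X' h h' =>
        simp only [map_add, LinearMap.add_apply, TensorProduct.add_tmul, h, h']
      | tmul u u' =>
        induction Y with
        | zero => simp
        | add Y Y' h h' => simp only [map_add, TensorProduct.add_tmul, h, h']
        | tmul v v' => simp

lemma coaction_auxR (X Y : A ⊗[ℂ] A) :
    C.rightAction.lTensor A (actR A Γ X (C.d.lTensor A Y)) =
        (TensorProduct.map₂ (LinearMap.mul ℂ A) (actL A Γ)
          ((Coalgebra.comul (R := ℂ) (A := A)).lTensor A X)
          ((C.d.rTensor A).lTensor A
            ((Coalgebra.comul (R := ℂ) (A := A)).lTensor A Y))) := by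
  induction X with
  | zero => simp
  | add X X' h h' => simp only [map_add, LinearMap.add_apply, h, h']
  | tmul x x' =>
    induction Y with
    | zero => simp
    | add Y Y' h h' => simp only [map_add, h, h']
    | tmul y y' => simp [C.rightAction_smul_d]

lemma leftAction_rightAction (ξ : Γ) :
    C.leftAction.rTensor A (C.rightAction ξ) =
      (TensorProduct.assoc ℂ A Γ A).symm (C.rightAction.lTensor A (C.leftAction ξ)) := by
  induction ξ using C.induction with
  | hadd x y hx hy => simp only [map_add, hx, hy]
  | h a b =>
    rw [C.rightAction_smul_d, C.leftAction_smul_d, C.coaction_auxL, C.coaction_auxR,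
      Coalgebra.coassoc_apply, Coalgebra.coassoc_apply]

lemma rightAction_mem (ϑ : C.inv) :
    C.rightAction ϑ ∈ LinearMap.range (C.inv.subtype.rTensor A) := by
  have hex : Function.Exact C.inv.subtype
      (C.leftAction - TensorProduct.mk ℂ A Γ 1 : Γ →ₗ[ℂ] A ⊗[ℂ] Γ) := by
    intro ξ
    simp [sub_eq_zero, mem_inv]
  rw [LinearMap.mem_range]
  refine (Module.Flat.rTensor_exact A hex _).1 ?_
  rw [LinearMap.rTensor_sub]
  change C.leftAction.rTensor A _ - (TensorProduct.mk ℂ A Γ 1).rTensor A _ = 0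
  rw [C.leftAction_rightAction, C.mem_inv.1 ϑ.2,
    sub_eq_zero, LinearMap.lTensor_tmul]
  generalize C.rightAction _ = Z
  induction Z with
  | zero => simp
  | add Z Z' h h' => simp only [TensorProduct.tmul_add, map_add, h, h']
  | tmul z a => simp

lemma inv_rTensor_injective : Function.Injective (C.inv.subtype.rTensor A) :=
  Module.Flat.rTensor_preserves_injective_linearMap _ C.inv.injective_subtype

/-- The adjoint action `ϖ : Γ_inv → Γ_inv ⊗ A`, i.e. the restriction of the right action. -/
def varpi : C.inv →ₗ[ℂ] C.inv ⊗[ℂ] A :=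
  (LinearEquiv.ofInjective _ C.inv_rTensor_injective).symm.toLinearMap ∘ₗ
    (C.rightAction ∘ₗ C.inv.subtype).codRestrict _ C.rightAction_mem

lemma rTensor_varpi (ϑ : C.inv) : C.inv.subtype.rTensor A (C.varpi ϑ) = C.rightAction ϑ := by
  have := LinearEquiv.apply_symm_apply (LinearEquiv.ofInjective _ C.inv_rTensor_injective)
    ((C.rightAction ∘ₗ C.inv.subtype).codRestrict _ C.rightAction_mem ϑ)
  exact congrArg Subtype.val this

end BicovariantCalculus

section GradedDifferential

/-- A graded-differential *-algebra structure on a complex algebra `Ω` with an antilinear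
involution: a grading by `ℕ`, a differential of degree one, with the graded Leibniz rule, and the
graded rule `(x y)* = (-1)^{|x||y|} y* x*` for the involution, which commutes with `d`. -/
structure GDStarAlgebra (Ω : Type*) [Ring Ω] [Algebra ℂ Ω] [StarAddMonoid Ω] [StarModule ℂ Ω] where
  deg : ℕ → Submodule ℂ Ω
  graded : GradedAlgebra deg
  d : Ω →ₗ[ℂ] Ω
  d_mem : ∀ n, ∀ x ∈ deg n, d x ∈ deg (n + 1)
  d_d : ∀ x, d (d x) = 0
  leibniz : ∀ p, ∀ x ∈ deg p, ∀ y, d (x * y) = d x * y + (-1 : ℂ) ^ p • (x * d y)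
  star_mem : ∀ n, ∀ x ∈ deg n, star x ∈ deg n
  star_mul : ∀ p q, ∀ x ∈ deg p, ∀ y ∈ deg q,
    star (x * y) = (-1 : ℂ) ^ (p * q) • (star y * star x)
  star_d : ∀ x, star (d x) = d (star x)

attribute [instance] GDStarAlgebra.graded

/-- The linear map multiplying the component of degree `n` by `s n`. -/
def gradeScale {Ω : Type*} [Ring Ω] [Algebra ℂ Ω] (𝒜 : ℕ → Submodule ℂ Ω) [GradedAlgebra 𝒜]
    (s : ℕ → ℂ) : Ω →ₗ[ℂ] Ω :=
  (DirectSum.decomposeLinearEquiv 𝒜).symm.toLinearMap ∘ₗ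
    DirectSum.lmap (fun n => s n • (LinearMap.id : 𝒜 n →ₗ[ℂ] 𝒜 n)) ∘ₗ
      (DirectSum.decomposeLinearEquiv 𝒜).toLinearMap

lemma gradeScale_of_mem {Ω : Type*} [Ring Ω] [Algebra ℂ Ω] (𝒜 : ℕ → Submodule ℂ Ω)
    [GradedAlgebra 𝒜] (s : ℕ → ℂ) {n : ℕ} {x : Ω} (hx : x ∈ 𝒜 n) :
    gradeScale 𝒜 s x = s n • x := by
  lift x to 𝒜 n using hx
  simp [gradeScale]

theorem graded_induction {Ω : Type*} [Ring Ω] [Algebra ℂ Ω] (𝒜 : ℕ → Submodule ℂ Ω)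
    [GradedAlgebra 𝒜] {p : Ω → Prop} (h : ∀ n, ∀ x ∈ 𝒜 n, p x)
    (hadd : ∀ x y, p x → p y → p (x + y)) (x : Ω) : p x :=
  DirectSum.Decomposition.inductionOn 𝒜 (h 0 0 (zero_mem _)) (fun {i} m => h i m m.2)
    (fun x y => hadd x y) x

namespace GDStarAlgebra

variable {Ω Λ : Type*} [Ring Ω] [Algebra ℂ Ω] [StarAddMonoid Ω] [StarModule ℂ Ω]
  [Ring Λ] [Algebra ℂ Λ] [StarAddMonoid Λ] [StarModule ℂ Λ]

/-- The grading involution `x ↦ (-1)^{|x|} x`. -/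
def sgn (S : GDStarAlgebra Ω) : Ω →ₗ[ℂ] Ω := gradeScale S.deg (fun n => (-1) ^ n)

lemma sgn_of_mem (S : GDStarAlgebra Ω) {n : ℕ} {x : Ω} (hx : x ∈ S.deg n) :
    S.sgn x = (-1 : ℂ) ^ n • x := gradeScale_of_mem _ _ hx

/-- The component of total degree `n` of a tensor product. -/
def tensorDeg (S : GDStarAlgebra Ω) (T : GDStarAlgebra Λ) (n : ℕ) : Submodule ℂ (Ω ⊗[ℂ] Λ) :=
  ⨆ (p : ℕ) (q : ℕ) (_ : p + q = n),
    LinearMap.range (TensorProduct.map (S.deg p).subtype (T.deg q).subtype)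

/-- The differential `x ⊗ y ↦ d x ⊗ y + (-1)^{|x|} x ⊗ d y` of a tensor product. -/
def tensorD (S : GDStarAlgebra Ω) (T : GDStarAlgebra Λ) : Ω ⊗[ℂ] Λ →ₗ[ℂ] Ω ⊗[ℂ] Λ :=
  TensorProduct.map S.d LinearMap.id + TensorProduct.map S.sgn T.d

lemma d_mul (S : GDStarAlgebra Ω) (x y : Ω) : S.d (x * y) = S.d x * y + S.sgn x * S.d y := by
  induction x using graded_induction S.deg with
  | h n x hx => rw [S.leibniz n x hx, S.sgn_of_mem hx, smul_mul_assoc]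
  | hadd x x' h h' => simp only [add_mul, map_add, h, h']; abel

lemma d_one (S : GDStarAlgebra Ω) : S.d 1 = 0 := by
  have h := S.leibniz 0 1 SetLike.GradedOne.one_mem 1
  simpa using h

lemma sgn_sgn (S : GDStarAlgebra Ω) (x : Ω) : S.sgn (S.sgn x) = x := by
  induction x using graded_induction S.deg with
  | h n x hx =>
    rw [S.sgn_of_mem hx, map_smul, S.sgn_of_mem hx, smul_smul, ← mul_pow]
    simp
  | hadd x x' h h' => simp only [map_add, h, h']

lemma d_sgn (S : GDStarAlgebra Ω) (x : Ω) : S.d (S.sgn x) = -S.sgn (S.d x) := by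
  induction x using graded_induction S.deg with
  | h n x hx =>
    rw [S.sgn_of_mem hx, map_smul, S.sgn_of_mem (S.d_mem _ _ hx), pow_succ]
    simp
  | hadd x x' h h' => simp only [map_add, h, h', neg_add]

end GDStarAlgebra

/-- The opposite of a complex algebra, with the complex conjugate scalar multiplication. Algebra
homomorphisms `R → ConjOp S` are the antilinear antihomomorphisms `R → S`. -/
def ConjOp (R : Type*) : Type _ := Rᵐᵒᵖ

instance (R : Type*) [Ring R] : Ring (ConjOp R) := inferInstanceAs (Ring Rᵐᵒᵖ)

/-- The identity, as a map to the conjugate opposite algebra. -/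
def toConjOp {R : Type*} [Ring R] : R ≃+ ConjOp R := opAddEquiv

lemma toConjOp_mul {R : Type*} [Ring R] (x y : R) :
    toConjOp (x * y) = toConjOp y * toConjOp x := rfl

lemma toConjOp_symm_mul {R : Type*} [Ring R] (x y : ConjOp R) :
    toConjOp.symm (x * y) = toConjOp.symm y * toConjOp.symm x := rfl

lemma toConjOp_one {R : Type*} [Ring R] : toConjOp (1 : R) = 1 := rfl

lemma toConjOp_symm_one {R : Type*} [Ring R] : toConjOp.symm (1 : ConjOp R) = 1 := rfl

instance (R : Type*) [Ring R] [Algebra ℂ R] : Algebra ℂ (ConjOp R) where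
  smul z x := toConjOp (star z • toConjOp.symm x)
  algebraMap :=
    { toFun := fun z => toConjOp (algebraMap ℂ R (star z))
      map_one' := by simp [toConjOp_one]
      map_mul' := fun z w => by
        rw [star_mul, map_mul, toConjOp_mul]
      map_zero' := by simp
      map_add' := fun z w => by simp }
  commutes' z x := by
    obtain ⟨x, rfl⟩ := toConjOp.surjective x
    change toConjOp _ * toConjOp _ = toConjOp _ * toConjOp _
    rw [← toConjOp_mul, ← toConjOp_mul, Algebra.commutes]
  smul_def' z x := by
    obtain ⟨x, rfl⟩ := toConjOp.surjective x
    change toConjOp (star z • x) = toConjOp _ * toConjOp _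
    rw [← toConjOp_mul, Algebra.smul_def, Algebra.commutes]

lemma toConjOp_smul {R : Type*} [Ring R] [Algebra ℂ R] (z : ℂ) (x : R) :
    toConjOp (z • x) = star z • toConjOp x := by
  change _ = toConjOp (star (star z) • x)
  rw [star_star]

lemma toConjOp_symm_smul {R : Type*} [Ring R] [Algebra ℂ R] (z : ℂ) (x : ConjOp R) :
    toConjOp.symm (z • x) = star z • toConjOp.symm x := rfl

end GradedDifferential

namespace BicovariantCalculus

variable {A Γ : Type*} [Ring A] [HopfAlgebra ℂ A] [StarRing A] [StarModule ℂ A]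
  [AddCommGroup Γ] [Module ℂ Γ] [Module A Γ] [Module Aᵐᵒᵖ Γ]
  [IsScalarTower ℂ A Γ] [IsScalarTower ℂ Aᵐᵒᵖ Γ] [SMulCommClass A Aᵐᵒᵖ Γ]
  [StarAddMonoid Γ] [StarModule ℂ Γ] (C : BicovariantCalculus A Γ)

/-- The generators `a ∈ A` of the envelope. -/
def preA : A →ₗ[ℂ] TensorAlgebra ℂ (A × Γ) := TensorAlgebra.ι ℂ ∘ₗ LinearMap.inl ℂ A Γ

/-- The generators `ξ ∈ Γ` of the envelope. -/
def preΓ : Γ →ₗ[ℂ] TensorAlgebra ℂ (A × Γ) := TensorAlgebra.ι ℂ ∘ₗ LinearMap.inr ℂ A Γ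

/-- The defining relations of the universal differential envelope. The first four make the
quotient of the free algebra on `A ⊕ Γ` the tensor bundle algebra of `Γ` over `A`; the last one
imposes `∑ d(aₖ) d(bₖ) = 0` whenever `∑ aₖ d(bₖ) = 0`. -/
inductive EnvelopeRel : TensorAlgebra ℂ (A × Γ) → TensorAlgebra ℂ (A × Γ) → Prop
  | one : EnvelopeRel (preA 1) 1
  | mul (a b : A) : EnvelopeRel (preA a * preA b) (preA (a * b))
  | smul (a : A) (ξ : Γ) : EnvelopeRel (preA a * preΓ ξ) (preΓ (a • ξ))
  | op_smul (ξ : Γ) (a : A) : EnvelopeRel (preΓ ξ * preA a) (preΓ (op a • ξ))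
  | dd (t : A ⊗[ℂ] A) (ht : C.adb t = 0) :
      EnvelopeRel (TensorProduct.lift
        ((LinearMap.mul ℂ (TensorAlgebra ℂ (A × Γ))).compl₁₂ (preΓ ∘ₗ C.d) (preΓ ∘ₗ C.d)) t) 0

/-- The universal differential envelope `Γ^∧` of the calculus: the quotient of the tensor bundle
algebra of `Γ` by the ideal generated by the elements `∑ d(aₖ) d(bₖ)` with `∑ aₖ d(bₖ) = 0`. -/
def Envelope : Type _ := RingQuot C.EnvelopeRel

namespace Envelope

instance : Ring C.Envelope := inferInstanceAs (Ring (RingQuot C.EnvelopeRel))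

instance : Algebra ℂ C.Envelope := inferInstanceAs (Algebra ℂ (RingQuot C.EnvelopeRel))

/-- The quotient map. -/
def mk : TensorAlgebra ℂ (A × Γ) →ₐ[ℂ] C.Envelope := RingQuot.mkAlgHom ℂ C.EnvelopeRel

lemma mk_surjective : Function.Surjective (mk C) := RingQuot.mkAlgHom_surjective _ _

/-- The degree zero part: `A → Γ^∧`. -/
def ofA : A →ₐ[ℂ] C.Envelope :=
  AlgHom.ofLinearMap ((mk C).toLinearMap ∘ₗ preA)
    (by
      have h : mk C (preA 1) = mk C 1 := RingQuot.mkAlgHom_rel ℂ (EnvelopeRel.one)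
      simpa using h)
    (fun a b => by
      have h : mk C (preA a * preA b) = mk C (preA (a * b)) :=
        RingQuot.mkAlgHom_rel ℂ (EnvelopeRel.mul a b)
      simpa using h.symm)

/-- The degree one part: `Γ → Γ^∧`. -/
def ofΓ : Γ →ₗ[ℂ] C.Envelope := (mk C).toLinearMap ∘ₗ preΓ

lemma mk_preA (a : A) : mk C (preA a) = ofA C a := rfl

lemma mk_preΓ (ξ : Γ) : mk C (preΓ ξ) = ofΓ C ξ := rfl

lemma ofΓ_smul (a : A) (ξ : Γ) : ofΓ C (a • ξ) = ofA C a * ofΓ C ξ := by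
  have h : mk C (preA a * preΓ ξ) = mk C (preΓ (a • ξ)) :=
    RingQuot.mkAlgHom_rel ℂ (EnvelopeRel.smul a ξ)
  rw [map_mul] at h
  exact h.symm

lemma ofΓ_op_smul (ξ : Γ) (a : A) : ofΓ C (op a • ξ) = ofΓ C ξ * ofA C a := by
  have h : mk C (preΓ ξ * preA a) = mk C (preΓ (op a • ξ)) :=
    RingQuot.mkAlgHom_rel ℂ (EnvelopeRel.op_smul ξ a)
  rw [map_mul] at h
  exact h.symm

/-- The linear map `a ⊗ b ↦ d(a) d(b)`. -/
def ddMap : A ⊗[ℂ] A →ₗ[ℂ] C.Envelope :=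
  TensorProduct.lift
    ((LinearMap.mul ℂ C.Envelope).compl₁₂ (ofΓ C ∘ₗ C.d) (ofΓ C ∘ₗ C.d))

@[simp] lemma ddMap_tmul (a b : A) :
    ddMap C (a ⊗ₜ b) = ofΓ C (C.d a) * ofΓ C (C.d b) := rfl

lemma ddMap_eq_zero (t : A ⊗[ℂ] A) (ht : C.adb t = 0) : ddMap C t = 0 := by
  have h := RingQuot.mkAlgHom_rel ℂ (EnvelopeRel.dd (C := C) t ht)
  change mk C _ = mk C _ at h
  rw [map_zero] at h
  rw [← h]
  clear h ht
  induction t with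
  | zero => simp
  | add x y hx hy => rw [map_add, hx, hy, map_add, map_add]
  | tmul a b => simp [mk_preΓ]

/-- The universal property of the envelope as an algebra. -/
def lift {R : Type*} [Ring R] [Algebra ℂ R] (f : A →ₐ[ℂ] R) (g : Γ →ₗ[ℂ] R)
    (h₁ : ∀ a ξ, g (a • ξ) = f a * g ξ) (h₂ : ∀ ξ a, g (op a • ξ) = g ξ * f a)
    (h₃ : ∀ t, C.adb t = 0 →
      TensorProduct.lift ((LinearMap.mul ℂ R).compl₁₂ (g ∘ₗ C.d) (g ∘ₗ C.d)) t = 0) :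
    C.Envelope →ₐ[ℂ] R :=
  RingQuot.liftAlgHom ℂ ⟨TensorAlgebra.lift ℂ (f.toLinearMap.coprod g), by
    intro x y hxy
    induction hxy with
    | one => simp [preA]
    | mul a b => simp [preA]
    | smul a ξ => simp [preA, preΓ, h₁]
    | op_smul ξ a => simp [preA, preΓ, h₂]
    | dd t ht =>
      rw [map_zero, ← h₃ t ht]
      clear ht
      induction t with
      | zero => simp
      | add x y hx hy => rw [map_add, map_add, hx, hy, map_add]
      | tmul a b => simp [preΓ]⟩

section lift

variable {R : Type*} [Ring R] [Algebra ℂ R] (f : A →ₐ[ℂ] R) (g : Γ →ₗ[ℂ] R)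
    (h₁ : ∀ a ξ, g (a • ξ) = f a * g ξ) (h₂ : ∀ ξ a, g (op a • ξ) = g ξ * f a)
    (h₃ : ∀ t, C.adb t = 0 →
      TensorProduct.lift ((LinearMap.mul ℂ R).compl₁₂ (g ∘ₗ C.d) (g ∘ₗ C.d)) t = 0)

@[simp] lemma lift_ofA (a : A) : lift C f g h₁ h₂ h₃ (ofA C a) = f a := by
  refine (RingQuot.liftAlgHom_mkAlgHom_apply ℂ _ _ _).trans ?_
  simp [preA]

@[simp] lemma lift_ofΓ (ξ : Γ) : lift C f g h₁ h₂ h₃ (ofΓ C ξ) = g ξ := by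
  refine (RingQuot.liftAlgHom_mkAlgHom_apply ℂ _ _ _).trans ?_
  simp [preΓ]

end lift

/-- The envelope is generated by `A` and `Γ`. -/
theorem induction {p : C.Envelope → Prop} (hA : ∀ a, p (ofA C a)) (hΓ : ∀ ξ, p (ofΓ C ξ))
    (hadd : ∀ x y, p x → p y → p (x + y)) (hmul : ∀ x y, p x → p y → p (x * y))
    (x : C.Envelope) : p x := by
  obtain ⟨t, rfl⟩ := mk_surjective C x
  induction t using TensorAlgebra.induction with
  | algebraMap r =>
    have h := hA (algebraMap ℂ A r)
    rwa [AlgHom.commutes] at h ⊢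
  | ι m =>
    have h : TensorAlgebra.ι ℂ m = (preA m.1 + preΓ m.2 : TensorAlgebra ℂ (A × Γ)) := by
      simp [preA, preΓ, ← map_add]
    rw [h, map_add]
    exact hadd _ _ (hA _) (hΓ _)
  | mul x y hx hy => rw [map_mul]; exact hmul _ _ hx hy
  | add x y hx hy => rw [map_add]; exact hadd _ _ hx hy

theorem hom_ext {R : Type*} [Ring R] [Algebra ℂ R] {f g : C.Envelope →ₐ[ℂ] R}
    (hA : ∀ a, f (ofA C a) = g (ofA C a)) (hΓ : ∀ ξ, f (ofΓ C ξ) = g (ofΓ C ξ)) : f = g := by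
  ext x
  induction x using induction C with
  | hA a => exact hA a
  | hΓ ξ => exact hΓ ξ
  | hadd x y hx hy => rw [map_add, map_add, hx, hy]
  | hmul x y hx hy => rw [map_mul, map_mul, hx, hy]

/-- The projection `p_* : Γ^∧ → A` onto the degree zero part. -/
def proj : C.Envelope →ₐ[ℂ] A :=
  lift C (AlgHom.id ℂ A) 0 (by simp) (by simp) (fun t ht => by
    clear ht
    induction t with
    | zero => simp
    | add x y hx hy => rw [map_add, hx, hy, add_zero]
    | tmul a b => simp)

open Polynomial in
/-- The algebra homomorphism `x ↦ x X^n` for `x` of degree `n`, which encodes the grading. -/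
def wt : C.Envelope →ₐ[ℂ] C.Envelope[X] :=
  lift C (CAlgHom.comp (ofA C)) ((monomial 1).restrictScalars ℂ ∘ₗ ofΓ C)
    (fun a ξ => by simp [ofΓ_smul, C_mul_monomial])
    (fun ξ a => by simp [ofΓ_op_smul, monomial_mul_C])
    (fun t ht => by
      have h : ∀ t, TensorProduct.lift ((LinearMap.mul ℂ C.Envelope[X]).compl₁₂
          (((monomial 1).restrictScalars ℂ ∘ₗ ofΓ C) ∘ₗ C.d)
          (((monomial 1).restrictScalars ℂ ∘ₗ ofΓ C) ∘ₗ C.d)) t =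
            monomial 2 (ddMap C t) := by
        intro t
        induction t with
        | zero => simp
        | add x y hx hy => simp only [map_add, hx, hy]
        | tmul a b => simp [monomial_mul_monomial]
      rw [h, ddMap_eq_zero C t ht, map_zero])

open Polynomial in
@[simp] lemma wt_ofA (a : A) : wt C (ofA C a) = Polynomial.C (ofA C a) := by simp [wt]

open Polynomial in
@[simp] lemma wt_ofΓ (ξ : Γ) : wt C (ofΓ C ξ) = monomial 1 (ofΓ C ξ) := by simp [wt]

/-- The component of degree `n` of the envelope. -/
def deg (n : ℕ) : Submodule ℂ C.Envelope where
  carrier := {x | wt C x = Polynomial.monomial n x}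
  add_mem' {x y} hx hy := by
    simp only [Set.mem_ofPred_eq] at hx hy ⊢
    rw [map_add, hx, hy, map_add]
  zero_mem' := by simp
  smul_mem' z x hx := by
    simp only [Set.mem_ofPred_eq] at hx ⊢
    rw [map_smul, hx, Polynomial.smul_monomial]

lemma mem_deg {n : ℕ} {x : C.Envelope} : x ∈ deg C n ↔ wt C x = Polynomial.monomial n x :=
  Iff.rfl

lemma ofA_mem (a : A) : ofA C a ∈ deg C 0 := by simp [mem_deg]

lemma ofΓ_mem (ξ : Γ) : ofΓ C ξ ∈ deg C 1 := by simp [mem_deg]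

instance : SetLike.GradedMonoid (deg C) where
  one_mem := by
    rw [← map_one (ofA C)]; exact ofA_mem C 1
  mul_mem i j x y hx hy := by
    rw [mem_deg] at hx hy ⊢
    rw [map_mul, hx, hy, Polynomial.monomial_mul_monomial]

/-- A property of homogeneous elements that holds for the components of the generators and is
stable under products and sums holds for all homogeneous components. -/
theorem coeff_induction {p : ℕ → C.Envelope → Prop} (h0 : ∀ n, p n 0)
    (hA : ∀ a, p 0 (ofA C a)) (hΓ : ∀ ξ, p 1 (ofΓ C ξ))
    (hadd : ∀ n x y, p n x → p n y → p n (x + y))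
    (hmul : ∀ m n x y, p m x → p n y → p (m + n) (x * y))
    (n : ℕ) (x : C.Envelope) : p n ((wt C x).coeff n) := by
  induction x using induction C generalizing n with
  | hA a =>
    rw [wt_ofA, Polynomial.coeff_C]
    split_ifs with h
    · subst h; exact hA a
    · exact h0 n
  | hΓ ξ =>
    rw [wt_ofΓ, Polynomial.coeff_monomial]
    split_ifs with h
    · subst h; exact hΓ ξ
    · exact h0 n
  | hadd x y hx hy => rw [map_add, Polynomial.coeff_add]; exact hadd _ _ _ (hx n) (hy n)
  | hmul x y hx hy =>
    rw [map_mul, Polynomial.coeff_mul]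
    refine Finset.sum_induction _ (p n) (fun a b => hadd n a b) (h0 n) ?_
    intro q hq
    rw [← Finset.HasAntidiagonal.mem_antidiagonal.1 hq]
    exact hmul _ _ _ _ (hx _) (hy _)

lemma coeff_of_mem {n : ℕ} {x : C.Envelope} (hx : x ∈ deg C n) : (wt C x).coeff n = x := by
  rw [(mem_deg C).1 hx, Polynomial.coeff_monomial_same]

theorem deg_induction {p : ∀ (n : ℕ) (x : C.Envelope), x ∈ deg C n → Prop}
    (h0 : ∀ n, p n 0 (zero_mem _))
    (hA : ∀ a, p 0 (ofA C a) (ofA_mem C a)) (hΓ : ∀ ξ, p 1 (ofΓ C ξ) (ofΓ_mem C ξ))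
    (hadd : ∀ n x y hx hy, p n x hx → p n y hy → p n (x + y) (add_mem hx hy))
    (hmul : ∀ m n x y hx hy, p m x hx → p n y hy →
      p (m + n) (x * y) (SetLike.mul_mem_graded hx hy))
    (n : ℕ) (x : C.Envelope) (hx : x ∈ deg C n) : p n x hx := by
  have h := coeff_induction C (p := fun n x => ∃ hx, p n x hx) (fun n => ⟨_, h0 n⟩)
    (fun a => ⟨_, hA a⟩) (fun ξ => ⟨_, hΓ ξ⟩)
    (fun n x y hx hy => ⟨_, hadd n x y _ _ hx.2 hy.2⟩)
    (fun m n x y hx hy => ⟨_, hmul m n x y _ _ hx.2 hy.2⟩) n x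
  rw [coeff_of_mem C hx] at h
  exact h.2

lemma coeff_mem (n : ℕ) (x : C.Envelope) : (wt C x).coeff n ∈ deg C n :=
  coeff_induction C (p := fun n x => x ∈ deg C n) (fun _ => zero_mem _) (ofA_mem C) (ofΓ_mem C)
    (fun _ _ _ => add_mem) (fun _ _ _ _ hx hy => SetLike.mul_mem_graded hx hy) n x

lemma eval_wt (x : C.Envelope) : (wt C x).eval 1 = x := by
  induction x using induction C with
  | hA a => simp
  | hΓ ξ => simp
  | hadd x y hx hy => simp [hx, hy]
  | hmul x y hx hy =>
    rw [Polynomial.eval] at hx hy ⊢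
    rw [map_mul, Polynomial.eval₂_mul_noncomm _ _ (fun k => Commute.one_right _), hx, hy]

lemma coe_directSum_apply (y : DirectSum ℕ (fun n => deg C n)) (n : ℕ) :
    (y n : C.Envelope) = (wt C (DirectSum.coeAddMonoidHom (deg C) y)).coeff n := by
  induction y using DirectSum.induction_on with
  | zero => simp
  | of i x =>
    rw [DirectSum.coeAddMonoidHom_of, (mem_deg C).1 x.2, Polynomial.coeff_monomial,
      DirectSum.of_apply]
    split_ifs with h
    · subst h; rfl
    · rfl
  | add x y hx hy => simp [hx, hy]

lemma coe_sum_coeff (x : C.Envelope) : DirectSum.coeAddMonoidHom (deg C)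
    (∑ n ∈ (wt C x).support, DirectSum.of (fun n => deg C n) n
      ⟨(wt C x).coeff n, coeff_mem C n x⟩) = x := by
  rw [map_sum]
  simp only [DirectSum.coeAddMonoidHom_of]
  conv_rhs => rw [← eval_wt C x, Polynomial.eval_eq_sum, Polynomial.sum]
  simp

instance graded : GradedAlgebra (deg C) where
  decompose' x := ∑ n ∈ (wt C x).support, DirectSum.of (fun n => deg C n) n
    ⟨(wt C x).coeff n, coeff_mem C n x⟩
  left_inv x := coe_sum_coeff C x
  right_inv y := by
    ext n
    rw [coe_directSum_apply, coe_sum_coeff, ← coe_directSum_apply]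

/-- The map `Γ → Γ^∧`, `a d(b) ↦ d(a) d(b)`. -/
def dΓ : Γ →ₗ[ℂ] C.Envelope :=
  (LinearMap.ker C.adb).liftQ (ddMap C) (fun t ht => ddMap_eq_zero C t ht) ∘ₗ
    (C.adb.quotKerEquivOfSurjective C.adb_surjective).symm.toLinearMap

lemma dΓ_adb (t : A ⊗[ℂ] A) : dΓ C (C.adb t) = ddMap C t := by
  have h : (C.adb.quotKerEquivOfSurjective C.adb_surjective).symm (C.adb t) =
      (LinearMap.ker C.adb).mkQ t := by
    rw [LinearEquiv.symm_apply_eq]; rfl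
  simp only [dΓ, LinearMap.comp_apply, LinearEquiv.coe_coe, h]
  exact Submodule.liftQ_apply _ _ _

lemma dΓ_smul_d (a b : A) : dΓ C (a • C.d b) = ofΓ C (C.d a) * ofΓ C (C.d b) := by
  rw [← adb_tmul, dΓ_adb, ddMap_tmul]

lemma dΓ_d (a : A) : dΓ C (C.d a) = 0 := by
  have h := dΓ_smul_d C 1 a
  rwa [one_smul, d_one, map_zero, zero_mul] at h

lemma dΓ_smul (a : A) (ξ : Γ) :
    dΓ C (a • ξ) = ofA C a * dΓ C ξ + ofΓ C (C.d a) * ofΓ C ξ := by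
  induction ξ using C.induction with
  | hadd x y hx hy => simp only [smul_add, map_add, mul_add, hx, hy]; abel
  | h b c =>
    rw [← mul_smul, dΓ_smul_d, dΓ_smul_d, C.leibniz, map_add, ofΓ_smul, ofΓ_op_smul, ofΓ_smul]
    noncomm_ring

lemma dΓ_op_smul (ξ : Γ) (a : A) :
    dΓ C (op a • ξ) = dΓ C ξ * ofA C a - ofΓ C ξ * ofΓ C (C.d a) := by
  induction ξ using C.induction with
  | hadd x y hx hy => simp only [smul_add, map_add, add_mul, hx, hy]; abel
  | h b c =>
    have h : op a • (b • C.d c) = b • C.d (c * a) - (b * c) • C.d a := by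
      rw [C.leibniz, smul_add, mul_smul, add_sub_cancel_left, ← smul_comm]
    rw [h, map_sub, dΓ_smul_d, dΓ_smul_d, dΓ_smul_d, C.leibniz, C.leibniz, map_add, map_add,
      ofΓ_smul, ofΓ_smul, ofΓ_op_smul, ofΓ_op_smul]
    noncomm_ring

/-- The algebra homomorphism `x ↦ ((-1)^{|x|} x, d x; 0, x)`, which encodes the differential. -/
def diffHom : C.Envelope →ₐ[ℂ] Matrix (Fin 2) (Fin 2) C.Envelope :=
  lift C
    (AlgHom.ofLinearMap
      { toFun := fun a => !![ofA C a, ofΓ C (C.d a); 0, ofA C a]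
        map_add' := fun a b => by simp
        map_smul' := fun z a => by simp }
      (by simp [d_one, Matrix.one_fin_two])
      (fun a b => by
        simp [C.leibniz, ofΓ_smul, ofΓ_op_smul]))
    { toFun := fun ξ => !![-ofΓ C ξ, dΓ C ξ; 0, ofΓ C ξ]
      map_add' := fun a b => by simp [add_comm]
      map_smul' := fun z a => by simp }
    (fun a ξ => by
      simp [dΓ_smul, ofΓ_smul])
    (fun ξ a => by
      simp [dΓ_op_smul, ofΓ_op_smul]
      abel)
    (fun t ht => by
      refine Eq.trans (b := !![ddMap C t, 0; 0, ddMap C t]) ?_ ?_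
      · clear ht
        induction t with
        | zero => ext i j; fin_cases i <;> fin_cases j <;> simp
        | add x y hx hy =>
          rw [map_add, hx, hy, map_add]
          ext i j; fin_cases i <;> fin_cases j <;> simp
        | tmul a b => simp [dΓ_d]
      · rw [ddMap_eq_zero C t ht]
        ext i j; fin_cases i <;> fin_cases j <;> simp)

lemma diffHom_ofA (a : A) : diffHom C (ofA C a) = !![ofA C a, ofΓ C (C.d a); 0, ofA C a] := by
  simp [diffHom]

lemma diffHom_ofΓ (ξ : Γ) : diffHom C (ofΓ C ξ) = !![-ofΓ C ξ, dΓ C ξ; 0, ofΓ C ξ] := by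
  simp [diffHom]

/-- The differential of the envelope. -/
def diff : C.Envelope →ₗ[ℂ] C.Envelope where
  toFun x := diffHom C x 0 1
  map_add' x y := by simp
  map_smul' z x := by simp

@[simp] lemma diff_ofA (a : A) : diff C (ofA C a) = ofΓ C (C.d a) := by
  simp [diff, diffHom_ofA]

@[simp] lemma diff_ofΓ (ξ : Γ) : diff C (ofΓ C ξ) = dΓ C ξ := by
  simp [diff, diffHom_ofΓ]

lemma diffHom_diag (n : ℕ) (x : C.Envelope) (hx : x ∈ deg C n) :
    diffHom C x 0 0 = (-1 : ℂ) ^ n • x ∧ diffHom C x 1 0 = 0 ∧ diffHom C x 1 1 = x := by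
  induction n, x, hx using deg_induction C with
  | h0 n => simp
  | hA a => simp [diffHom_ofA]
  | hΓ ξ => simp [diffHom_ofΓ]
  | hadd n x y _ _ hx hy => simp [hx, hy]
  | hmul m n x y _ _ hx hy => simp [Matrix.mul_apply, hx, hy, smul_smul, pow_add, mul_comm]

lemma diff_mul (p : ℕ) (x : C.Envelope) (hx : x ∈ deg C p) (y : C.Envelope) :
    diff C (x * y) = diff C x * y + (-1 : ℂ) ^ p • (x * diff C y) := by
  induction y using graded_induction (deg C) with
  | h n y hy =>
    simp [diff, Matrix.mul_apply, diffHom_diag C p x hx, diffHom_diag C n y hy, add_comm]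
  | hadd y y' h h' => simp only [mul_add, map_add, h, h', smul_add]; abel

lemma dΓ_mem (ξ : Γ) : dΓ C ξ ∈ deg C 2 := by
  induction ξ using C.induction with
  | h a b => rw [dΓ_smul_d]; exact SetLike.mul_mem_graded (ofΓ_mem C _) (ofΓ_mem C _)
  | hadd x y hx hy => rw [map_add]; exact add_mem hx hy

lemma diff_mem (n : ℕ) (x : C.Envelope) (hx : x ∈ deg C n) : diff C x ∈ deg C (n + 1) := by
  induction n, x, hx using deg_induction C with
  | h0 n => simp
  | hA a => simpa using ofΓ_mem C _
  | hΓ ξ => simpa using dΓ_mem C ξ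
  | hadd n x y _ _ hx hy => rw [map_add]; exact add_mem hx hy
  | hmul m n x y hmx hmy hx hy =>
    rw [diff_mul C m x hmx]
    refine add_mem ?_ (Submodule.smul_mem _ _ ?_)
    · have h := SetLike.mul_mem_graded hx hmy
      rwa [add_right_comm] at h
    · have h := SetLike.mul_mem_graded hmx hy
      rwa [← add_assoc] at h

lemma diff_dΓ (ξ : Γ) : diff C (dΓ C ξ) = 0 := by
  induction ξ using C.induction with
  | h a b =>
    rw [dΓ_smul_d, diff_mul C 1 _ (ofΓ_mem C _), diff_ofΓ, diff_ofΓ, dΓ_d, dΓ_d]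
    simp
  | hadd x y hx hy => rw [map_add, map_add, hx, hy, add_zero]

lemma diff_diff (x : C.Envelope) : diff C (diff C x) = 0 := by
  induction x using graded_induction (deg C) with
  | hadd x y hx hy => rw [map_add, map_add, hx, hy, add_zero]
  | h n x hx =>
    induction n, x, hx using deg_induction C with
    | h0 n => simp
    | hA a => simp [dΓ_d]
    | hΓ ξ => simp [diff_dΓ]
    | hadd n x y _ _ hx hy => rw [map_add, map_add, hx, hy, add_zero]
    | hmul m n x y hmx _ hx hy =>
      rw [diff_mul C m x hmx, map_add, map_smul, diff_mul C m x hmx,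
        diff_mul C (m + 1) _ (diff_mem C m x hmx), hx, hy, pow_succ]
      simp

/-- The antilinear antihomomorphism of the envelope extending the involutions of `A` and `Γ`,
without the graded signs. -/
def dagger : C.Envelope →ₐ[ℂ] ConjOp C.Envelope :=
  lift C
    (AlgHom.ofLinearMap
      { toFun := fun a => toConjOp (ofA C (star a))
        map_add' := fun a b => by simp
        map_smul' := fun z a => by
          rw [StarModule.star_smul, map_smul, toConjOp_smul, star_star, RingHom.id_apply] }
      (by simp [toConjOp_one])
      (fun a b => by
        change toConjOp _ = toConjOp _ * toConjOp _
        rw [star_mul, map_mul, toConjOp_mul]))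
    { toFun := fun ξ => toConjOp (ofΓ C (star ξ))
      map_add' := fun a b => by simp
      map_smul' := fun z a => by
        rw [StarModule.star_smul, map_smul, toConjOp_smul, star_star, RingHom.id_apply] }
    (fun a ξ => by
      change toConjOp _ = toConjOp _ * toConjOp _
      rw [C.star_smul, ofΓ_op_smul, toConjOp_mul])
    (fun ξ a => by
      change toConjOp _ = toConjOp _ * toConjOp _
      rw [C.star_op_smul, ofΓ_smul, toConjOp_mul])
    (fun t ht => by
      refine Eq.trans (b := toConjOp (-dΓ C (star (C.adb t)))) ?_ (by simp [ht])
      clear ht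
      induction t with
      | zero => simp
      | add x y hx hy => rw [map_add, hx, hy, ← map_add]; simp [add_comm]
      | tmul a b =>
        change (toConjOp (ofΓ C (star (C.d a))) * toConjOp (ofΓ C (star (C.d b))) :
          ConjOp C.Envelope) = _
        rw [← toConjOp_mul, adb_tmul, C.star_smul_d, dΓ_op_smul, dΓ_d, C.star_d, C.star_d]
        simp)

/-- The underlying additive map of `dagger`. -/
def dag : C.Envelope →+ C.Envelope :=
  (toConjOp.symm : ConjOp C.Envelope ≃+ C.Envelope).toAddMonoidHom.comp
    (dagger C : C.Envelope →+ ConjOp C.Envelope)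

lemma dag_mul (x y : C.Envelope) : dag C (x * y) = dag C y * dag C x := by
  change toConjOp.symm (dagger C (x * y)) = _
  rw [map_mul, toConjOp_symm_mul]; rfl

lemma dag_smul (z : ℂ) (x : C.Envelope) : dag C (z • x) = star z • dag C x := by
  change toConjOp.symm (dagger C (z • x)) = _
  rw [map_smul, toConjOp_symm_smul]; rfl

@[simp] lemma dag_ofA (a : A) : dag C (ofA C a) = ofA C (star a) := by
  change toConjOp.symm (dagger C (ofA C a)) = _
  simp [dagger]

@[simp] lemma dag_ofΓ (ξ : Γ) : dag C (ofΓ C ξ) = ofΓ C (star ξ) := by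
  change toConjOp.symm (dagger C (ofΓ C ξ)) = _
  simp [dagger]

lemma dag_dag (x : C.Envelope) : dag C (dag C x) = x := by
  induction x using induction C with
  | hA a => simp
  | hΓ ξ => simp
  | hadd x y hx hy => simp [hx, hy]
  | hmul x y hx hy => simp [dag_mul, hx, hy]

lemma dag_mem (n : ℕ) (x : C.Envelope) (hx : x ∈ deg C n) : dag C x ∈ deg C n := by
  induction n, x, hx using deg_induction C with
  | h0 n => simp
  | hA a => simpa using ofA_mem C _
  | hΓ ξ => simpa using ofΓ_mem C _
  | hadd n x y _ _ hx hy => rw [map_add]; exact add_mem hx hy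
  | hmul m n x y _ _ hx hy =>
    rw [dag_mul, add_comm]; exact SetLike.mul_mem_graded hy hx

lemma dag_diff (n : ℕ) (x : C.Envelope) (hx : x ∈ deg C n) :
    dag C (diff C x) = (-1 : ℂ) ^ n • diff C (dag C x) := by
  induction n, x, hx using deg_induction C with
  | h0 n => simp
  | hA a => simp [C.star_d]
  | hΓ ξ =>
    rw [diff_ofΓ, dag_ofΓ, diff_ofΓ]
    induction ξ using C.induction with
    | h a b =>
      rw [dΓ_smul_d, dag_mul, C.star_smul_d, dΓ_op_smul, dΓ_d]
      simp [C.star_d]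
    | hadd x y hx hy => simp only [map_add, star_add, smul_add, hx, hy]
  | hadd n x y _ _ hx hy => simp only [map_add, hx, hy, smul_add]
  | hmul m n x y hmx hmy hx hy =>
    rw [diff_mul C m x hmx, map_add, dag_smul, dag_mul, dag_mul, dag_mul, hx, hy,
      diff_mul C n _ (dag_mem C n y hmy)]
    simp only [mul_smul_comm, smul_mul_assoc, smul_add, smul_smul, star_pow, star_neg, star_one,
      ← pow_add]
    rw [add_comm]
    congr 2
    rw [add_assoc, ← two_mul n, pow_add, pow_mul]
    simp

/-- The sign `(-1)^{n(n-1)/2}` relating the graded and the ungraded involution in degree `n`. -/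
def starSign (n : ℕ) : ℂ := (-1) ^ (n.choose 2)

lemma starSign_mul_self (n : ℕ) : starSign n * starSign n = 1 := by
  rw [starSign, ← mul_pow]; simp

lemma star_starSign (n : ℕ) : star (starSign n) = starSign n := by simp [starSign]

lemma starSign_add (m n : ℕ) : starSign (m + n) = starSign m * starSign n * (-1) ^ (m * n) := by
  rw [starSign, starSign, starSign, ← pow_add, ← pow_add]
  congr 1
  induction n with
  | zero => simp
  | succ n ih => 
    rw [← add_assoc, Nat.choose_succ_succ' (m + n) 1, ih, Nat.choose_succ_succ' n 1]
    simp; ring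

/-- The graded involution of the envelope. -/
instance : StarAddMonoid C.Envelope where
  star x := gradeScale (deg C) starSign (dag C x)
  star_involutive x := by
    induction x using graded_induction (deg C) with
    | h n x hx =>
      change gradeScale _ _ (dag C (gradeScale _ _ (dag C x))) = x
      rw [gradeScale_of_mem _ _ (dag_mem C n x hx), dag_smul, dag_dag, map_smul,
        gradeScale_of_mem _ _ hx, smul_smul, star_starSign, starSign_mul_self, one_smul]
    | hadd x y hx hy =>
      change gradeScale _ _ (dag C (gradeScale _ _ (dag C (x + y)))) = x + y
      simp only [map_add]
      exact congrArg₂ (· + ·) hx hy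
  star_add x y := by
    change gradeScale _ _ (dag C (x + y)) = gradeScale _ _ (dag C x) + gradeScale _ _ (dag C y)
    simp only [map_add]

instance : StarModule ℂ C.Envelope where
  star_smul z x := by
    change gradeScale _ _ (dag C (z • x)) = star z • gradeScale _ _ (dag C x)
    rw [dag_smul, map_smul]

lemma star_of_mem {n : ℕ} {x : C.Envelope} (hx : x ∈ deg C n) :
    star x = starSign n • dag C x :=
  gradeScale_of_mem _ _ (dag_mem C n x hx)

lemma star_ofA (a : A) : star (ofA C a) = ofA C (star a) := by
  rw [star_of_mem C (ofA_mem C a)]; simp [starSign]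

lemma star_ofΓ (ξ : Γ) : star (ofΓ C ξ) = ofΓ C (star ξ) := by
  rw [star_of_mem C (ofΓ_mem C ξ)]; simp [starSign]

/-- The graded-differential *-algebra structure of the universal differential envelope. -/
def gdStar : GDStarAlgebra C.Envelope where
  deg := deg C
  graded := graded C
  d := diff C
  d_mem := diff_mem C
  d_d := diff_diff C
  leibniz := diff_mul C
  star_mem n x hx := by
    rw [star_of_mem C hx]; exact Submodule.smul_mem _ _ (dag_mem C n x hx)
  star_mul p q x hx y hy := by
    rw [star_of_mem C (SetLike.mul_mem_graded hx hy), star_of_mem C hx, star_of_mem C hy,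
      dag_mul, starSign_add, smul_mul_smul_comm, smul_smul]
    congr 1; ring
  star_d x := by
    induction x using graded_induction (deg C) with
    | hadd x y hx hy => simp only [map_add, star_add, hx, hy]
    | h n x hx =>
      rw [star_of_mem C (diff_mem C n x hx), star_of_mem C hx, map_smul, dag_diff C n x hx,
        smul_smul, starSign_add, mul_one, mul_assoc, ← mul_pow]
      simp [starSign]

end Envelope

end BicovariantCalculus

/-- A quantum principal bundle: *-algebras `V` of functions on the base and `B` of functions on the
total space, a unital *-monomorphism `i : V → B`, and a right coaction `F : B → B ⊗ A` by a unital
*-homomorphism, whose fixed-point subalgebra is `i(V)` and which is free in the sense that the map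
`q ⊗ b ↦ q F(b)` is surjective. -/
structure QuantumPrincipalBundle (A V B : Type*) [Ring A] [HopfAlgebra ℂ A] [StarRing A]
    [StarModule ℂ A] [Ring V] [Algebra ℂ V] [StarRing V] [StarModule ℂ V]
    [Ring B] [Algebra ℂ B] [StarRing B] [StarModule ℂ B] where
  i : V →⋆ₐ[ℂ] B
  i_injective : Function.Injective i
  F : B →⋆ₐ[ℂ] B ⊗[ℂ] A
  coassoc : ∀ b : B, TensorProduct.assoc ℂ B A A ((F : B →ₗ[ℂ] B ⊗[ℂ] A).rTensor A (F b)) =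
    (Coalgebra.comul (R := ℂ) (A := A)).lTensor B (F b)
  counit : ∀ b : B, (Coalgebra.counit (R := ℂ) (A := A)).lTensor B (F b) = b ⊗ₜ 1
  fixed : ∀ b : B, F b = b ⊗ₜ 1 ↔ b ∈ Set.range i
  free : ∀ t : B ⊗[ℂ] A, t ∈ Submodule.span ℂ {s | ∃ q b : B, s = (q ⊗ₜ 1) * F b}

/-- A differential calculus on a quantum principal bundle `P`, relative to the calculus `C` on the
structure group: a graded-differential *-algebra `Ω` with `Ω⁰ = B`, generated by `B` as a
differential algebra, such that the right action `F` extends to a homomorphism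
`Ω → Ω ⊗̂ Γ^∧` of graded-differential *-algebras. -/
structure BundleCalculus {A Γ V B : Type*} [Ring A] [HopfAlgebra ℂ A] [StarRing A]
    [StarModule ℂ A] [AddCommGroup Γ] [Module ℂ Γ] [Module A Γ] [Module Aᵐᵒᵖ Γ]
    [IsScalarTower ℂ A Γ] [IsScalarTower ℂ Aᵐᵒᵖ Γ] [SMulCommClass A Aᵐᵒᵖ Γ]
    [StarAddMonoid Γ] [StarModule ℂ Γ]
    [Ring V] [Algebra ℂ V] [StarRing V] [StarModule ℂ V]
    [Ring B] [Algebra ℂ B] [StarRing B] [StarModule ℂ B]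
    (C : BicovariantCalculus A Γ) (P : QuantumPrincipalBundle A V B)
    (Ω : Type*) [Ring Ω] [Algebra ℂ Ω] [StarAddMonoid Ω] [StarModule ℂ Ω] where
  gd : GDStarAlgebra Ω
  incl : B →ₐ[ℂ] Ω
  incl_injective : Function.Injective incl
  range_incl : LinearMap.range incl.toLinearMap = gd.deg 0
  incl_star : ∀ b, incl (star b) = star (incl b)
  generated : ∀ S : Subalgebra ℂ Ω, (∀ b, incl b ∈ S) → (∀ x ∈ S, gd.d x ∈ S) → S = ⊤
  action : Ω →ₐ[ℂ] gd.deg ᵍ⊗[ℂ] (BicovariantCalculus.Envelope.gdStar C).deg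
  action_deg : ∀ n, ∀ x ∈ gd.deg n, (GradedTensorProduct.of ℂ _ _).symm (action x) ∈
    gd.tensorDeg (BicovariantCalculus.Envelope.gdStar C) n
  action_d : ∀ x, (GradedTensorProduct.of ℂ _ _).symm (action (gd.d x)) =
    gd.tensorD (BicovariantCalculus.Envelope.gdStar C)
      ((GradedTensorProduct.of ℂ _ _).symm (action x))
  action_star : ∀ x, (GradedTensorProduct.of ℂ _ _).symm (action (star x)) =
    star ((GradedTensorProduct.of ℂ _ _).symm (action x))
  action_incl : ∀ b, (GradedTensorProduct.of ℂ _ _).symm (action (incl b)) =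
    TensorProduct.map incl.toLinearMap (BicovariantCalculus.Envelope.ofA C).toLinearMap (P.F b)

section EmbeddedDifferential

variable {A Γ : Type*} [Ring A] [HopfAlgebra ℂ A] [StarRing A]
    [StarModule ℂ A] [AddCommGroup Γ] [Module ℂ Γ] [Module A Γ] [Module Aᵐᵒᵖ Γ]
    [IsScalarTower ℂ A Γ] [IsScalarTower ℂ Aᵐᵒᵖ Γ] [SMulCommClass A Aᵐᵒᵖ Γ]
    [StarAddMonoid Γ] [StarModule ℂ Γ]

namespace BicovariantCalculus

/-- The adjoint action on `Γ_inv ⊗ Γ_inv`: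
`ϑ ⊗ η ↦ ∑ ϑₖ ⊗ ηₗ ⊗ cₖ dₗ` if `ϖ(ϑ) = ∑ ϑₖ ⊗ cₖ` and `ϖ(η) = ∑ ηₗ ⊗ dₗ`. -/
def varpi₂ (C : BicovariantCalculus A Γ) :
    C.inv ⊗[ℂ] C.inv →ₗ[ℂ] (C.inv ⊗[ℂ] C.inv) ⊗[ℂ] A :=
  (LinearMap.mul' ℂ A).lTensor (C.inv ⊗[ℂ] C.inv) ∘ₗ
    (TensorProduct.tensorTensorTensorComm ℂ C.inv A C.inv A).toLinearMap ∘ₗ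
      TensorProduct.map C.varpi C.varpi

/-- The adjoint action on the tensor algebra `Γ_inv^⊗`, an algebra homomorphism. -/
def varpiT (C : BicovariantCalculus A Γ) :
    TensorAlgebra ℂ C.inv →ₐ[ℂ] TensorAlgebra ℂ C.inv ⊗[ℂ] A :=
  TensorAlgebra.lift ℂ ((TensorAlgebra.ι ℂ).rTensor A ∘ₗ C.varpi)

/-- The algebra `I` of invariant elements of `Γ_inv^⊗`. -/
def invariants (C : BicovariantCalculus A Γ) : Subalgebra ℂ (TensorAlgebra ℂ C.inv) :=
  AlgHom.equalizer C.varpiT Algebra.TensorProduct.includeLeft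

end BicovariantCalculus

/-- An embedded differential: a hermitian linear map `δ : Γ_inv → Γ_inv ⊗ Γ_inv` that intertwines
the adjoint actions and satisfies `d(ϑ) = ∑ ϑ¹ ϑ²` in the universal envelope if
`δ(ϑ) = ∑ ϑ¹ ⊗ ϑ²`. The involution of `Γ_inv ⊗ Γ_inv` is the graded one,
`(ϑ ⊗ η)* = -η* ⊗ ϑ*`. -/
structure EmbeddedDifferential [HopfStarAlgebra A] (C : BicovariantCalculus A Γ) where
  δ : C.inv →ₗ[ℂ] C.inv ⊗[ℂ] C.inv
  lifts : ∀ ϑ : C.inv,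
    LinearMap.mul' ℂ C.Envelope
      (TensorProduct.map (BicovariantCalculus.Envelope.ofΓ C ∘ₗ C.inv.subtype)
        (BicovariantCalculus.Envelope.ofΓ C ∘ₗ C.inv.subtype) (δ ϑ)) =
      (BicovariantCalculus.Envelope.gdStar C).d (BicovariantCalculus.Envelope.ofΓ C ϑ)
  intertwines : ∀ ϑ : C.inv, δ.rTensor A (C.varpi ϑ) = C.varpi₂ (δ ϑ)
  hermitian : ∀ ϑ : C.inv, δ (star ϑ) = -TensorProduct.comm ℂ C.inv C.inv (star (δ ϑ))

end EmbeddedDifferential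

/-- The antilinear antimultiplicative extension of the involution of `M` to the tensor algebra:
`(ϑ₁ ⊗ ⋯ ⊗ ϑₙ)* = ϑₙ* ⊗ ⋯ ⊗ ϑ₁*`. -/
def tensorStar {M : Type*} [AddCommGroup M] [Module ℂ M] [StarAddMonoid M] [StarModule ℂ M] :
    TensorAlgebra ℂ M →+ TensorAlgebra ℂ M :=
  (toConjOp.symm : ConjOp (TensorAlgebra ℂ M) ≃+ TensorAlgebra ℂ M).toAddMonoidHom.comp
    (TensorAlgebra.lift ℂ
      ({ toFun := fun m => toConjOp (TensorAlgebra.ι ℂ (star m))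
         map_add' := fun a b => by simp
         map_smul' := fun z a => by
          rw [StarModule.star_smul, map_smul, toConjOp_smul, star_star, RingHom.id_apply] } :
        M →ₗ[ℂ] ConjOp (TensorAlgebra ℂ M)) : TensorAlgebra ℂ M →+ ConjOp (TensorAlgebra ℂ M))

lemma tensorStar_mul {M : Type*} [AddCommGroup M] [Module ℂ M] [StarAddMonoid M] [StarModule ℂ M]
    (x y : TensorAlgebra ℂ M) : tensorStar (x * y) = tensorStar y * tensorStar x := by
  simp only [tensorStar, AddMonoidHom.comp_apply, AddMonoidHom.coe_coe, map_mul]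
  rfl

lemma tensorStar_ι {M : Type*} [AddCommGroup M] [Module ℂ M] [StarAddMonoid M] [StarModule ℂ M]
    (m : M) : tensorStar (TensorAlgebra.ι ℂ m) = TensorAlgebra.ι ℂ (star m) := by
  simp only [tensorStar, AddMonoidHom.comp_apply, AddMonoidHom.coe_coe, TensorAlgebra.lift_ι_apply]
  rfl

lemma tensorStar_smul {M : Type*} [AddCommGroup M] [Module ℂ M] [StarAddMonoid M]
    [StarModule ℂ M] (z : ℂ) (x : TensorAlgebra ℂ M) :
    tensorStar (z • x) = star z • tensorStar x := by
  simp only [tensorStar, AddMonoidHom.comp_apply, AddMonoidHom.coe_coe, map_smul]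
  rfl

namespace BundleCalculus

variable {A Γ V B Ω : Type*} [Ring A] [HopfAlgebra ℂ A] [StarRing A]
    [StarModule ℂ A] [AddCommGroup Γ] [Module ℂ Γ] [Module A Γ] [Module Aᵐᵒᵖ Γ]
    [IsScalarTower ℂ A Γ] [IsScalarTower ℂ Aᵐᵒᵖ Γ] [SMulCommClass A Aᵐᵒᵖ Γ]
    [StarAddMonoid Γ] [StarModule ℂ Γ]
    [Ring V] [Algebra ℂ V] [StarRing V] [StarModule ℂ V]
    [Ring B] [Algebra ℂ B] [StarRing B] [StarModule ℂ B]
    {C : BicovariantCalculus A Γ} {P : QuantumPrincipalBundle A V B}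
    [Ring Ω] [Algebra ℂ Ω] [StarAddMonoid Ω] [StarModule ℂ Ω] (X : BundleCalculus C P Ω)

/-- The map `F̂ : Ω(P) → Ω(P) ⊗ Γ^∧`, with values in the underlying tensor product of vector
spaces. -/
def hatF : Ω →ₗ[ℂ] Ω ⊗[ℂ] C.Envelope :=
  (GradedTensorProduct.of ℂ X.gd.deg
    (BicovariantCalculus.Envelope.gdStar C).deg).symm.toLinearMap ∘ₗ X.action.toLinearMap

/-- The right action `F^∧ = (id ⊗ p_*) F̂` of the structure group on `Ω(P)`. -/
def wedgeF : Ω →ₗ[ℂ] Ω ⊗[ℂ] A :=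
  (BicovariantCalculus.Envelope.proj C).toLinearMap.lTensor Ω ∘ₗ X.hatF

/-- The horizontal forms `F̂⁻¹(Ω(P) ⊗ A)`. -/
def hor : Submodule ℂ Ω :=
  (LinearMap.range ((BicovariantCalculus.Envelope.ofA C).toLinearMap.lTensor Ω)).comap X.hatF

/-- The differential forms on the base: the `F̂`-invariant forms. -/
def baseForms : Subalgebra ℂ Ω :=
  AlgHom.equalizer X.action (GradedTensorProduct.includeLeft _ _)

lemma mem_baseForms {x : Ω} : x ∈ X.baseForms ↔ X.hatF x = x ⊗ₜ 1 := by
  change X.action x = GradedTensorProduct.of ℂ _ _ (x ⊗ₜ 1) ↔ _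
  rw [← LinearEquiv.symm_apply_eq]
  rfl

lemma d_mem_baseForms {x : Ω} (hx : x ∈ X.baseForms) : X.gd.d x ∈ X.baseForms := by
  rw [mem_baseForms] at hx ⊢
  refine (X.action_d x).trans ?_
  change X.gd.tensorD _ (X.hatF x) = _
  rw [hx, GDStarAlgebra.tensorD]
  simp [GDStarAlgebra.d_one]

lemma star_mem_baseForms {x : Ω} (hx : x ∈ X.baseForms) : star x ∈ X.baseForms := by
  rw [mem_baseForms] at hx ⊢
  refine (X.action_star x).trans ?_
  change star (X.hatF x) = _
  rw [hx, TensorProduct.star_tmul, ← map_one (BicovariantCalculus.Envelope.ofA C),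
    BicovariantCalculus.Envelope.star_ofA, star_one]

lemma tensorSgn_of_mem (n : ℕ) (t : Ω ⊗[ℂ] C.Envelope)
    (ht : t ∈ X.gd.tensorDeg (BicovariantCalculus.Envelope.gdStar C) n) :
    TensorProduct.map X.gd.sgn (BicovariantCalculus.Envelope.gdStar C).sgn t =
      (-1 : ℂ) ^ n • t := by
  have h : X.gd.tensorDeg (BicovariantCalculus.Envelope.gdStar C) n ≤
      LinearMap.eqLocus (TensorProduct.map X.gd.sgn (BicovariantCalculus.Envelope.gdStar C).sgn)
        ((-1 : ℂ) ^ n • LinearMap.id) := by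
    refine iSup_le fun p => iSup_le fun q => iSup_le fun hpq => ?_
    rintro _ ⟨s, rfl⟩
    induction s with
    | zero => simp
    | add s s' h h' => rw [map_add]; exact add_mem h h'
    | tmul x y =>
      simp only [LinearMap.mem_eqLocus, TensorProduct.map_tmul, Submodule.subtype_apply,
        GDStarAlgebra.sgn_of_mem _ x.2, GDStarAlgebra.sgn_of_mem _ y.2]
      rw [TensorProduct.smul_tmul_smul, ← pow_add, hpq]
      rfl
  exact h ht

lemma sgn_mem_baseForms {x : Ω} (hx : x ∈ X.baseForms) : X.gd.sgn x ∈ X.baseForms := by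
  have h : ∀ x, X.hatF (X.gd.sgn x) =
      TensorProduct.map X.gd.sgn (BicovariantCalculus.Envelope.gdStar C).sgn (X.hatF x) := by
    intro x
    induction x using graded_induction X.gd.deg with
    | hadd x y hx hy => simp only [map_add, hx, hy]
    | h n x hx =>
      rw [X.gd.sgn_of_mem hx, map_smul]
      exact (X.tensorSgn_of_mem n _ (X.action_deg n x hx)).symm
  rw [mem_baseForms] at hx ⊢
  rw [h, hx, TensorProduct.map_tmul, GDStarAlgebra.sgn_of_mem _ SetLike.GradedOne.one_mem]
  simp

/-- The closed forms on the base. -/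
def cocycles : Subalgebra ℂ Ω where
  carrier := {x | x ∈ X.baseForms ∧ X.gd.d x = 0}
  mul_mem' {x y} hx hy := ⟨mul_mem hx.1 hy.1, by rw [X.gd.d_mul, hx.2, hy.2]; simp⟩
  add_mem' {x y} hx hy := ⟨add_mem hx.1 hy.1, by rw [map_add, hx.2, hy.2, add_zero]⟩
  algebraMap_mem' z := ⟨algebraMap_mem _ z, by
    rw [Algebra.algebraMap_eq_smul_one, map_smul, X.gd.d_one, smul_zero]⟩

/-- The exact forms on the base, as an ideal of the algebra of closed forms. -/
def coboundaries : Ideal X.cocycles where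
  carrier := {z | ∃ η ∈ X.baseForms, X.gd.d η = z}
  add_mem' := by
    rintro _ _ ⟨η, hη, h⟩ ⟨η', hη', h'⟩
    exact ⟨η + η', add_mem hη hη', by rw [map_add, h, h']; rfl⟩
  zero_mem' := ⟨0, zero_mem _, by simp⟩
  smul_mem' := by
    rintro z _ ⟨η, hη, h⟩
    refine ⟨X.gd.sgn z * η, mul_mem (X.sgn_mem_baseForms z.2.1) hη, ?_⟩
    rw [X.gd.d_mul, X.gd.d_sgn, z.2.2, X.gd.sgn_sgn, h]
    simp

instance : X.coboundaries.IsTwoSided where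
  mul_mem_of_left := by
    rintro _ z ⟨η, hη, h⟩
    exact ⟨η * z, mul_mem hη z.2.1, by rw [X.gd.d_mul, z.2.2, h]; simp⟩

/-- The cohomology algebra `H(M)` of the base. -/
abbrev Cohomology : Type _ := X.cocycles ⧸ X.coboundaries

/-- The cohomology class of a closed form. -/
def cls : X.cocycles →ₐ[ℂ] X.Cohomology := Ideal.Quotient.mkₐ ℂ X.coboundaries

/-- The involution of `H(M)`, `[x]* = [x*]`. -/
def starH : X.Cohomology →+ X.Cohomology :=
  QuotientAddGroup.map _ _
    { toFun := fun z => ⟨star (z : Ω), X.star_mem_baseForms z.2.1, by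
        rw [← X.gd.star_d, z.2.2, star_zero]⟩
      map_zero' := Subtype.ext (star_zero Ω)
      map_add' := fun x y => Subtype.ext (star_add (x : Ω) (y : Ω)) }
    (by
      rintro z ⟨η, hη, h⟩
      exact ⟨star η, X.star_mem_baseForms hη, by rw [← X.gd.star_d, h]; rfl⟩)

/-- Connections: hermitian linear maps `ω : Γ_inv → Ω¹(P)` with
`F̂ ω(ϑ) = ∑ ω(ϑₖ) ⊗ cₖ + 1 ⊗ ϑ`, where `ϖ(ϑ) = ∑ ϑₖ ⊗ cₖ`. -/
structure IsConnection [HopfStarAlgebra A] (ω : C.inv →ₗ[ℂ] Ω) : Prop where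
  deg_one : ∀ ϑ, ω ϑ ∈ X.gd.deg 1
  hermitian : ∀ ϑ, ω (star ϑ) = star (ω ϑ)
  hatF : ∀ ϑ : C.inv, X.hatF (ω ϑ) =
    TensorProduct.map ω (BicovariantCalculus.Envelope.ofA C).toLinearMap (C.varpi ϑ) +
      1 ⊗ₜ BicovariantCalculus.Envelope.ofΓ C ϑ

/-- Pseudotensorial `n`-forms of type `ϖ`: linear maps `Γ_inv → Ωⁿ(P)` that intertwine `ϖ` and
`F^∧`. -/
structure IsPseudotensorial (n : ℕ) (φ : C.inv →ₗ[ℂ] Ω) : Prop where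
  deg_mem : ∀ ϑ, φ ϑ ∈ X.gd.deg n
  wedgeF : ∀ ϑ : C.inv, X.wedgeF (φ ϑ) = φ.rTensor A (C.varpi ϑ)

variable [HopfStarAlgebra A] (δ : EmbeddedDifferential C)

/-- The bracket `⟨φ, ψ⟩(ϑ) = ∑ φ(ϑ¹) ψ(ϑ²)`, where `δ(ϑ) = ∑ ϑ¹ ⊗ ϑ²`. -/
def bracket (φ ψ : C.inv →ₗ[ℂ] Ω) : C.inv →ₗ[ℂ] Ω :=
  LinearMap.mul' ℂ Ω ∘ₗ TensorProduct.map φ ψ ∘ₗ δ.δ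

/-- The curvature `R_ω = d ω - ⟨ω, ω⟩`. -/
def curvature (ω : C.inv →ₗ[ℂ] Ω) : C.inv →ₗ[ℂ] Ω := X.gd.d ∘ₗ ω - bracket δ ω ω

/-- The unital multiplicative extension `R_ω^⊗ : Γ_inv^⊗ → Ω(P)` of the curvature. Its restriction
to the invariant elements is `W^ω`. -/
def weilForm (ω : C.inv →ₗ[ℂ] Ω) : TensorAlgebra ℂ C.inv →ₐ[ℂ] Ω :=
  TensorAlgebra.lift ℂ (X.curvature δ ω)

/-- The two-sided ideal `𝒦_ω` of `Ω(P)` generated by the elements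
`⟨ω, φ⟩(ϑ) - (-1)^{|φ|} ⟨φ, ω⟩(ϑ)` with `φ` pseudotensorial of type `ϖ`. -/
def idealK (ω : C.inv →ₗ[ℂ] Ω) : TwoSidedIdeal Ω :=
  TwoSidedIdeal.span {x | ∃ (n : ℕ) (φ : C.inv →ₗ[ℂ] Ω) (ϑ : C.inv), X.IsPseudotensorial n φ ∧
    x = bracket δ ω φ ϑ - (-1 : ℂ) ^ n • bracket δ φ ω ϑ}

/-- The splitting condition `hor(P) ∩ 𝒦_ω = {0}`. -/
def Splitting (ω : C.inv →ₗ[ℂ] Ω) : Prop := ∀ x ∈ X.hor, x ∈ X.idealK δ ω → x = 0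

end BundleCalculus

end

end QuantumBundle

open QuantumBundle

/-!
The splitting assumption is used in one way only: a form on the base that lies in `𝒦_ω` vanishes.
The curvature `R_ω` of a connection is tensorial: the inhomogeneous terms of `F̂(R_ω(ϑ))` are those
which compare `d ϑ` with `∑ ϑ¹ ϑ²` under the coproduct of `Γ^∧`, and they cancel in bidegree
`(1, 1)`. Hence `W^ω(ϑ)` is a form on the base when `ϑ` is invariant. The generators of `𝒦_ω` give
`⟨ω, ω⟩ ∈ 𝒦_ω` and `⟨ω, R_ω⟩ - ⟨R_ω, ω⟩ ∈ 𝒦_ω`, so the Bianchi identity yields `d R_ω ∈ 𝒦_ω`, then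
`d W^ω(ϑ) ∈ 𝒦_ω`, and `W^ω(ϑ)` is closed.

For two connections `τ` and `τ + φ`, the form `W^{τ + tφ}(ϑ)` is polynomial in `t`. Its derivative
replaces one factor `R` at a time by `d φ - ⟨ω, φ⟩ - ⟨φ, ω⟩`, where `ω = τ + tφ`; this is `d φ`
modulo `𝒦_ω`. By the splitting assumption the derivative is therefore the differential of the form
obtained by replacing one factor `R` at a time by `φ`, and integration over the unit interval gives
the transgression. Only real `t` stay in the affine space, but a complex polynomial is determined
by its values at real points, so its coefficients, and with them the integral, are forms on the
base.
-/

namespace QuantumBundle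

noncomputable section

section TensorAlgebraDerivation

variable {k M R S : Type*} [CommRing k] [AddCommGroup M] [Module k M]
  [Ring R] [Algebra k R] [Ring S] [Algebra k S]

lemma algHom_comp_lift (e : R →ₐ[k] S) (f : M →ₗ[k] R) :
    e.comp (TensorAlgebra.lift k f) = TensorAlgebra.lift k (e.toLinearMap ∘ₗ f) := by
  ext m
  simp

lemma algHom_lift_apply (e : R →ₐ[k] S) (f : M →ₗ[k] R) (x : TensorAlgebra k M) :
    e (TensorAlgebra.lift k f x) = TensorAlgebra.lift k (e.toLinearMap ∘ₗ f) x :=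
  DFunLike.congr_fun (algHom_comp_lift e f) x

lemma algHom_comp_mul'_comp_map {N : Type*} [AddCommGroup N] [Module k N] (e : R →ₐ[k] S)
    (f : M →ₗ[k] R) (g : N →ₗ[k] R) :
    e.toLinearMap ∘ₗ LinearMap.mul' k R ∘ₗ TensorProduct.map f g =
      LinearMap.mul' k S ∘ₗ TensorProduct.map (e.toLinearMap ∘ₗ f) (e.toLinearMap ∘ₗ g) := by
  ext x y
  simp

/-- The derivation `x₁ ⊗ ⋯ ⊗ xₙ ↦ ∑ f(x₁) ⋯ g(xᵢ) ⋯ f(xₙ)` of the tensor algebra along the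
multiplicative extension of `f`. It is the second component of the algebra homomorphism into the
square-zero extension of `R` by itself that extends `x ↦ f(x) + ε g(x)`. -/
def derivationAlong (f g : M →ₗ[k] R) : TensorAlgebra k M →ₗ[k] R :=
  (TrivSqZeroExt.sndHom R R).restrictScalars k ∘ₗ
    (TensorAlgebra.lift k ((TrivSqZeroExt.inlAlgHom k R R).toLinearMap ∘ₗ f +
      (TrivSqZeroExt.inrHom R R).restrictScalars k ∘ₗ g)).toLinearMap

variable (f g : M →ₗ[k] R)

@[simp] lemma derivationAlong_ι (m : M) : derivationAlong f g (TensorAlgebra.ι k m) = g m := by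
  simp [derivationAlong]

@[simp] lemma derivationAlong_algebraMap (r : k) :
    derivationAlong f g (algebraMap k _ r) = 0 := by
  simp only [derivationAlong, LinearMap.comp_apply, AlgHom.toLinearMap_apply, AlgHom.commutes]
  rfl

lemma derivationAlong_mul (x y : TensorAlgebra k M) :
    derivationAlong f g (x * y) = TensorAlgebra.lift k f x * derivationAlong f g y +
      derivationAlong f g x * TensorAlgebra.lift k f y := by
  have hfst (z : TensorAlgebra k M) : (TensorAlgebra.lift k
      ((TrivSqZeroExt.inlAlgHom k R R).toLinearMap ∘ₗ f +
        (TrivSqZeroExt.inrHom R R).restrictScalars k ∘ₗ g) z).fst = TensorAlgebra.lift k f z := by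
    refine (algHom_lift_apply (TrivSqZeroExt.fstHom k R R) _ z).trans ?_
    congr 2
    ext m
    simp
  simp only [← hfst, derivationAlong, LinearMap.comp_apply, AlgHom.toLinearMap_apply, map_mul]
  exact TrivSqZeroExt.snd_mul _ _

variable {f g} in
theorem eq_derivationAlong {D : TensorAlgebra k M →ₗ[k] R}
    (hι : ∀ m, D (TensorAlgebra.ι k m) = g m)
    (hmul : ∀ x y, D (x * y) = TensorAlgebra.lift k f x * D y + D x * TensorAlgebra.lift k f y) :
    D = derivationAlong f g := by
  have hone : D 1 = 0 := by simpa using hmul 1 1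
  ext x
  induction x using TensorAlgebra.induction with
  | algebraMap r => rw [derivationAlong_algebraMap, Algebra.algebraMap_eq_smul_one, map_smul, hone,
      smul_zero]
  | ι m => rw [hι, derivationAlong_ι]
  | add x y hx hy => rw [map_add, map_add, hx, hy]
  | mul x y hx hy => rw [hmul, derivationAlong_mul, hx, hy]

lemma algHom_comp_derivationAlong (e : R →ₐ[k] S) :
    e.toLinearMap ∘ₗ derivationAlong f g =
      derivationAlong (e.toLinearMap ∘ₗ f) (e.toLinearMap ∘ₗ g) :=
  eq_derivationAlong (fun m => by simp)
    (fun x y => by simp [derivationAlong_mul, ← algHom_lift_apply])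

lemma rTensor_derivationAlong_mul (u v : TensorAlgebra k M ⊗[k] S) :
    (derivationAlong f g).rTensor S (u * v) =
      (TensorAlgebra.lift k f).toLinearMap.rTensor S u * (derivationAlong f g).rTensor S v +
        (derivationAlong f g).rTensor S u * (TensorAlgebra.lift k f).toLinearMap.rTensor S v := by
  induction u with
  | zero => simp only [zero_mul, map_zero, add_zero]
  | add u u' h h' => simp only [add_mul, map_add, h, h']; abel
  | tmul x a =>
    induction v with
    | zero => simp only [mul_zero, map_zero, add_zero]
    | add v v' h h' => simp only [mul_add, map_add, h, h']; abel
    | tmul y b => simp [derivationAlong_mul, TensorProduct.add_tmul]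

end TensorAlgebraDerivation

section PolynomialPath

open Polynomial

variable {k V R : Type*} [Field k] [AddCommGroup V] [Module k V] [Ring R] [Algebra k R]

/-- Evaluation of a polynomial with noncommuting coefficients at a scalar, an algebra
homomorphism since scalars are central: `p` is regarded as the path `z ↦ evalScalar z p`. -/
def evalScalar (z : k) : R[X] →ₐ[k] R :=
  { eval₂RingHom' (RingHom.id R) (algebraMap k R z) (fun a => (Algebra.commutes z a).symm) with
    commutes' := fun _ => eval₂_C _ _ }

@[simp] lemma evalScalar_monomial (z : k) (n : ℕ) (a : R) :
    evalScalar z (monomial n a) = z ^ n • a := by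
  change eval₂ _ _ _ = _
  rw [eval₂_monomial, ← map_pow, Algebra.smul_def, Algebra.commutes]
  rfl

@[simp] lemma evalScalar_C (z : k) (a : R) : evalScalar z (C a) = a := by
  rw [← monomial_zero_left, evalScalar_monomial, pow_zero, one_smul]

lemma evalScalar_eq_sum_range (z : k) {p : R[X]} {N : ℕ} (hN : p.natDegree < N) :
    evalScalar z p = ∑ n ∈ Finset.range N, z ^ n • p.coeff n := by
  conv_lhs => rw [p.as_sum_range' N hN]
  simp only [map_sum, evalScalar_monomial]

theorem mem_of_forall_sum_pow_smul_mem {W : Submodule k V} {T : Set k} (hT : T.Infinite) {N : ℕ}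
    {v : ℕ → V} (h : ∀ t ∈ T, ∑ n ∈ Finset.range N, t ^ n • v n ∈ W) {n : ℕ} (hn : n < N) :
    v n ∈ W := by
  by_contra hnW
  obtain ⟨f, hf, hW⟩ := Submodule.exists_le_ker_of_notMem hnW
  let q : k[X] := ∑ i ∈ Finset.range N, monomial i (f (v i))
  have hq : q = 0 := by
    refine eq_of_infinite_eval_eq q 0 (hT.mono fun t ht => ?_)
    have hzero : f (∑ i ∈ Finset.range N, t ^ i • v i) = 0 := hW (h t ht)
    simpa [q, eval_finsetSum, mul_comm] using hzero
  refine hf ?_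
  simpa [q, finsetSum_coeff, coeff_monomial, hn] using congrArg (fun q : k[X] => q.coeff n) hq

theorem coeff_mem_of_forall_evalScalar_mem {W : Submodule k R} {T : Set k} (hT : T.Infinite)
    {p : R[X]} (h : ∀ t ∈ T, evalScalar t p ∈ W) (n : ℕ) : p.coeff n ∈ W := by
  refine mem_of_forall_sum_pow_smul_mem hT (N := max p.natDegree n + 1) (fun t ht => ?_) (by omega)
  rw [← evalScalar_eq_sum_range t (by omega)]
  exact h t ht

lemma evalScalar_mem_of_coeff_mem {W : Submodule k R} {p : R[X]} (h : ∀ n, p.coeff n ∈ W) (z : k) :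
    evalScalar z p ∈ W := by
  rw [evalScalar_eq_sum_range z p.natDegree.lt_succ_self]
  exact W.sum_mem fun n _ => W.smul_mem _ (h n)

lemma evalScalar_derivative_mem {W : Submodule k R} {p : R[X]} (h : ∀ n, p.coeff n ∈ W) (z : k) :
    evalScalar z (derivative p) ∈ W := by
  refine evalScalar_mem_of_coeff_mem (fun n => ?_) z
  rw [coeff_derivative, ← Nat.cast_succ, ← nsmul_eq_mul']
  exact W.nsmul_mem (h _) _

lemma evalScalar_one_sub_evalScalar_zero {p : R[X]} {N : ℕ} (hN : p.natDegree ≤ N) :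
    evalScalar (1 : k) p - evalScalar (0 : k) p = ∑ n ∈ Finset.range N, p.coeff (n + 1) := by
  rw [evalScalar_eq_sum_range _ (Nat.lt_succ_of_le hN),
    evalScalar_eq_sum_range _ (Nat.lt_succ_of_le hN), Finset.sum_range_succ',
    Finset.sum_range_succ']
  simp

/-- The integral of the path `z ↦ evalScalar z q` over the unit interval, computed
coefficientwise. -/
def integralZeroOne (k : Type*) {R : Type*} [Field k] [Ring R] [Algebra k R] (q : R[X]) : R :=
  q.sum fun n a => ((n : k) + 1)⁻¹ • a

lemma integralZeroOne_mem_of_coeff_mem {W : Submodule k R} {q : R[X]} (h : ∀ n, q.coeff n ∈ W) :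
    integralZeroOne k q ∈ W :=
  W.sum_mem fun n _ => W.smul_mem _ (h n)

lemma coeff_succ_eq_smul_coeff_derivative [CharZero k] (p : R[X]) (n : ℕ) :
    p.coeff (n + 1) = ((n : k) + 1)⁻¹ • (derivative p).coeff n := by
  have hn : (n : k) + 1 ≠ 0 := Nat.cast_add_one_ne_zero n
  have hcast : (n : R) + 1 = algebraMap k R ((n : k) + 1) := by simp
  rw [coeff_derivative, hcast, ← Algebra.commutes, ← Algebra.smul_def, inv_smul_smul₀ hn]

/-- The fundamental theorem of calculus, with a linear map `D` moved out of the integral. -/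
theorem evalScalar_one_sub_zero_eq_integralZeroOne [CharZero k] {T : Set k} (hT : T.Infinite)
    (D : R →ₗ[k] R) {p q : R[X]}
    (h : ∀ t ∈ T, evalScalar t (derivative p) = D (evalScalar t q)) :
    evalScalar (1 : k) p - evalScalar (0 : k) p = D (integralZeroOne k q) := by
  set N := max p.natDegree q.natDegree + 1
  have hp' : (derivative p).natDegree < N := (natDegree_derivative_le p).trans_lt (by omega)
  have hq : q.natDegree < N := by omega
  have hcoeff : ∀ n < N, (derivative p).coeff n = D (q.coeff n) := fun n hn =>
    sub_eq_zero.1 <| (Submodule.mem_bot k).1 <| mem_of_forall_sum_pow_smul_mem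
      (v := fun n => (derivative p).coeff n - D (q.coeff n)) hT (fun t ht => by
        have ht := h t ht
        rw [evalScalar_eq_sum_range t hp', evalScalar_eq_sum_range t hq, map_sum] at ht
        simp only [smul_sub, Finset.sum_sub_distrib, ht, map_smul, sub_self, Submodule.zero_mem])
      hn
  rw [evalScalar_one_sub_evalScalar_zero (N := N) (by omega), integralZeroOne,
    sum_over_range' _ (fun n => smul_zero _) N hq, map_sum]
  refine Finset.sum_congr rfl fun n hn => ?_
  rw [coeff_succ_eq_smul_coeff_derivative (k := k), hcoeff n (Finset.mem_range.1 hn), map_smul]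

section LinearPath

variable {M N : Type*} [AddCommGroup M] [Module k M] [AddCommGroup N] [Module k N]

/-- The path `z ↦ f + z • g` of linear maps, as a polynomial in `z`. -/
def linearPath (f g : M →ₗ[k] R) : M →ₗ[k] R[X] :=
  (monomial 0).restrictScalars k ∘ₗ f + (monomial 1).restrictScalars k ∘ₗ g

lemma evalScalar_comp_linearPath (f g : M →ₗ[k] R) (z : k) :
    (evalScalar z).toLinearMap ∘ₗ linearPath f g = f + z • g := by
  ext m
  simp [linearPath]

lemma derivative_comp_linearPath (f g : M →ₗ[k] R) :
    derivative.restrictScalars k ∘ₗ linearPath f g = (monomial 0).restrictScalars k ∘ₗ g := by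
  ext1 m
  simp [linearPath]

lemma derivative_comp_lift (f : M →ₗ[k] R[X]) :
    derivative.restrictScalars k ∘ₗ (TensorAlgebra.lift k f).toLinearMap =
      derivationAlong f (derivative.restrictScalars k ∘ₗ f) :=
  eq_derivationAlong (fun m => by simp) (fun x y => by simp [derivative_mul, add_comm])

lemma derivative_comp_mul'_comp_map (f : M →ₗ[k] R[X]) (g : N →ₗ[k] R[X]) :
    derivative.restrictScalars k ∘ₗ LinearMap.mul' k R[X] ∘ₗ TensorProduct.map f g =
      LinearMap.mul' k R[X] ∘ₗ TensorProduct.map (derivative.restrictScalars k ∘ₗ f) g +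
        LinearMap.mul' k R[X] ∘ₗ TensorProduct.map f (derivative.restrictScalars k ∘ₗ g) := by
  ext1
  ext1 m
  ext1 n
  simp [derivative_mul]

end LinearPath

end PolynomialPath

section TensorStar

variable {M : Type*} [AddCommGroup M] [Module ℂ M] [StarAddMonoid M] [StarModule ℂ M]

lemma tensorStar_algebraMap (r : ℂ) :
    tensorStar (algebraMap ℂ (TensorAlgebra ℂ M) r) = algebraMap ℂ _ (star r) := by
  simp only [tensorStar, AddMonoidHom.comp_apply, AddMonoidHom.coe_coe, AlgHom.commutes]
  rfl

instance : StarRing (TensorAlgebra ℂ M) where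
  star := tensorStar
  star_involutive x := by
    induction x using TensorAlgebra.induction with
    | algebraMap r => rw [tensorStar_algebraMap, tensorStar_algebraMap, star_star]
    | ι m => rw [tensorStar_ι, tensorStar_ι, star_star]
    | add x y hx hy => rw [map_add, map_add, hx, hy]
    | mul x y hx hy => rw [tensorStar_mul, tensorStar_mul, hx, hy]
  star_add := map_add tensorStar
  star_mul := tensorStar_mul

instance : StarModule ℂ (TensorAlgebra ℂ M) where
  star_smul := tensorStar_smul

end TensorStar

namespace GDStarAlgebra

section Involutions

variable {Ω : Type*} [Ring Ω] [Algebra ℂ Ω] [StarAddMonoid Ω] [StarModule ℂ Ω]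
  (S : GDStarAlgebra Ω)

lemma sgn_of_mem_zero {x : Ω} (hx : x ∈ S.deg 0) : S.sgn x = x := by
  rw [S.sgn_of_mem hx, pow_zero, one_smul]

lemma sgn_of_mem_one {x : Ω} (hx : x ∈ S.deg 1) : S.sgn x = -x := by
  rw [S.sgn_of_mem hx, pow_one, neg_one_smul]

lemma sgn_one : S.sgn 1 = 1 := S.sgn_of_mem_zero SetLike.GradedOne.one_mem

lemma sgn_mul (x y : Ω) : S.sgn (x * y) = S.sgn x * S.sgn y := by
  induction x using graded_induction S.deg with
  | hadd x x' h h' => simp only [map_add, add_mul, h, h']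
  | h p x hx =>
    induction y using graded_induction S.deg with
    | hadd x x' h h' => simp only [map_add, mul_add, h, h']
    | h q y hy =>
      rw [S.sgn_of_mem hx, S.sgn_of_mem hy, S.sgn_of_mem (SetLike.mul_mem_graded hx hy),
        smul_mul_smul_comm, pow_add]

lemma sgn_pow_of_mem {p : ℕ} {x : Ω} (hx : x ∈ S.deg p) (q : ℕ) :
    (S.sgn ^ q) x = (-1 : ℂ) ^ (p * q) • x := by
  induction q with
  | zero => simp only [pow_zero, mul_zero, Module.End.one_apply, one_smul]
  | succ q ih =>
    rw [pow_succ', Module.End.mul_apply, ih, map_smul, S.sgn_of_mem hx, smul_smul, ← pow_add,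
      Nat.mul_succ]

lemma star_mul_of_right_mem (x : Ω) {q : ℕ} {y : Ω} (hy : y ∈ S.deg q) :
    star (x * y) = star y * star ((S.sgn ^ q) x) := by
  induction x using graded_induction S.deg with
  | hadd x x' h h' => rw [add_mul, star_add, h, h', map_add, star_add, mul_add]
  | h p x hx =>
    rw [S.star_mul p q x hx y hy, S.sgn_pow_of_mem hx, StarModule.star_smul, star_pow, star_neg,
      star_one, mul_smul_comm]

lemma star_mul_of_sgn_eq {x : Ω} (hx : S.sgn x = x) (y : Ω) :
    star (x * y) = star y * star x := by
  induction y using graded_induction S.deg with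
  | hadd y y' h h' => rw [mul_add, star_add, h, h', star_add, add_mul]
  | h q y hy =>
    rw [S.star_mul_of_right_mem x hy, Module.End.pow_apply, Function.iterate_fixed hx]

section MulMap

variable {M : Type*} [AddCommGroup M] [Module ℂ M] {f : M →ₗ[ℂ] Ω} (hf : ∀ m, f m ∈ S.deg 1)

include hf

lemma mul'_map_mem_deg_two (z : M ⊗[ℂ] M) :
    LinearMap.mul' ℂ Ω (TensorProduct.map f f z) ∈ S.deg 2 := by
  induction z with
  | zero => simp only [map_zero, Submodule.zero_mem]
  | add x y hx hy => simp only [map_add]; exact add_mem hx hy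
  | tmul x y => exact SetLike.mul_mem_graded (hf x) (hf y)

lemma d_mul'_map {N : Type*} [AddCommGroup N] [Module ℂ N] (g : N →ₗ[ℂ] Ω) (z : M ⊗[ℂ] N) :
    S.d (LinearMap.mul' ℂ Ω (TensorProduct.map f g z)) =
      LinearMap.mul' ℂ Ω (TensorProduct.map (S.d ∘ₗ f) g z) -
        LinearMap.mul' ℂ Ω (TensorProduct.map f (S.d ∘ₗ g) z) := by
  induction z with
  | zero => simp only [map_zero, sub_zero]
  | add x y hx hy => simp only [map_add, hx, hy]; abel
  | tmul x y => simp [S.d_mul, S.sgn_of_mem_one (hf x), sub_eq_add_neg]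

lemma star_mul'_map [StarAddMonoid M] [StarModule ℂ M] (hstar : ∀ m, f (star m) = star (f m))
    (z : M ⊗[ℂ] M) : star (LinearMap.mul' ℂ Ω (TensorProduct.map f f z)) =
      LinearMap.mul' ℂ Ω (TensorProduct.map f f (-TensorProduct.comm ℂ M M (star z))) := by
  induction z with
  | zero => simp only [map_zero, star_zero, neg_zero]
  | add x y hx hy => simp only [map_add, star_add, neg_add, hx, hy]
  | tmul x y =>
    simp [hstar, S.star_mul 1 1 _ (hf x) _ (hf y)]

end MulMap

end Involutions

section TensorAlgebra

variable {Ω M : Type*} [Ring Ω] [Algebra ℂ Ω] [StarAddMonoid Ω] [StarModule ℂ Ω]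
  [AddCommGroup M] [Module ℂ M] (S : GDStarAlgebra Ω) {f g : M →ₗ[ℂ] Ω}

lemma sgn_lift (hf : ∀ m, S.sgn (f m) = f m) (x : TensorAlgebra ℂ M) :
    S.sgn (TensorAlgebra.lift ℂ f x) = TensorAlgebra.lift ℂ f x := by
  refine (algHom_lift_apply (AlgHom.ofLinearMap S.sgn S.sgn_one S.sgn_mul) f x).trans ?_
  congr 2
  exact LinearMap.ext hf

variable (I : TwoSidedIdeal Ω)

lemma d_lift_mem (hf : ∀ m, S.sgn (f m) = f m) (hd : ∀ m, S.d (f m) ∈ I)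
    (x : TensorAlgebra ℂ M) : S.d (TensorAlgebra.lift ℂ f x) ∈ I := by
  induction x using TensorAlgebra.induction with
  | algebraMap r =>
    rw [AlgHom.commutes, Algebra.algebraMap_eq_smul_one, map_smul, S.d_one, smul_zero]
    exact I.zero_mem
  | ι m => rw [TensorAlgebra.lift_ι_apply]; exact hd m
  | add x y hx hy => rw [map_add, map_add]; exact I.add_mem hx hy
  | mul x y hx hy =>
    rw [map_mul, S.d_mul, S.sgn_lift hf]
    exact I.add_mem (I.mul_mem_right _ _ hx) (I.mul_mem_left _ _ hy)

lemma d_derivationAlong_sub_mem {g' : M →ₗ[ℂ] Ω} (hf : ∀ m, S.sgn (f m) = f m)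
    (hd : ∀ m, S.d (f m) ∈ I) (hg : ∀ m, S.d (g m) - g' m ∈ I) (x : TensorAlgebra ℂ M) :
    S.d (derivationAlong f g x) - derivationAlong f g' x ∈ I := by
  induction x using TensorAlgebra.induction with
  | algebraMap r => simp only [derivationAlong_algebraMap, map_zero, sub_zero]; exact I.zero_mem
  | ι m => simpa only [derivationAlong_ι] using hg m
  | add x y hx hy =>
    simp only [map_add, add_sub_add_comm]
    exact I.add_mem hx hy
  | mul x y hx hy =>
    set F := TensorAlgebra.lift ℂ f
    have hexpand : S.d (derivationAlong f g (x * y)) - derivationAlong f g' (x * y) =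
        (S.d (F x) * derivationAlong f g y +
          F x * (S.d (derivationAlong f g y) - derivationAlong f g' y)) +
        ((S.d (derivationAlong f g x) - derivationAlong f g' x) * F y +
          S.sgn (derivationAlong f g x) * S.d (F y)) := by
      simp only [derivationAlong_mul, map_add, S.d_mul, F, S.sgn_lift hf]
      noncomm_ring
    rw [hexpand]
    exact I.add_mem
      (I.add_mem (I.mul_mem_right _ _ (S.d_lift_mem I hf hd x)) (I.mul_mem_left _ _ hy))
      (I.add_mem (I.mul_mem_right _ _ hx) (I.mul_mem_left _ _ (S.d_lift_mem I hf hd y)))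

lemma star_lift [StarAddMonoid M] [StarModule ℂ M] (hf : ∀ m, S.sgn (f m) = f m)
    (hstar : ∀ m, f (star m) = star (f m)) (x : TensorAlgebra ℂ M) :
    star (TensorAlgebra.lift ℂ f x) = TensorAlgebra.lift ℂ f (tensorStar x) := by
  have hone : star (1 : Ω) = 1 := by
    simpa only [one_mul, star_star, mul_one] using (S.star_mul_of_sgn_eq S.sgn_one (star 1)).symm
  induction x using TensorAlgebra.induction with
  | algebraMap r =>
    rw [tensorStar_algebraMap, AlgHom.commutes, AlgHom.commutes, Algebra.algebraMap_eq_smul_one,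
      Algebra.algebraMap_eq_smul_one, StarModule.star_smul, hone]
  | ι m => rw [tensorStar_ι, TensorAlgebra.lift_ι_apply, TensorAlgebra.lift_ι_apply, hstar]
  | add x y hx hy => simp only [map_add, star_add, hx, hy]
  | mul x y hx hy =>
    rw [tensorStar_mul, map_mul, map_mul, S.star_mul_of_sgn_eq (S.sgn_lift hf x), hx, hy]

end TensorAlgebra

section GradedTensor

variable {Ω Λ : Type*} [Ring Ω] [Algebra ℂ Ω] [StarAddMonoid Ω] [StarModule ℂ Ω]
  [Ring Λ] [Algebra ℂ Λ] [StarAddMonoid Λ] [StarModule ℂ Λ]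
  (S : GDStarAlgebra Ω) (T : GDStarAlgebra Λ)

/-- The graded tensor product `Ω ⊗̂ Λ`, with the product
`(x ⊗ a) (y ⊗ b) = (-1)^{|a||y|} x y ⊗ a b`. -/
abbrev GTensor : Type _ := S.deg ᵍ⊗[ℂ] T.deg

/-- The identification of the vector spaces underlying `Ω ⊗ Λ` and `Ω ⊗̂ Λ`. -/
abbrev toGTensor : Ω ⊗[ℂ] Λ ≃ₗ[ℂ] S.GTensor T := GradedTensorProduct.of ℂ S.deg T.deg

variable {S T}

lemma toGTensor_mul_toGTensor {i j : ℕ} (x : Ω) {a : Λ} (ha : a ∈ T.deg i) {y : Ω}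
    (hy : y ∈ S.deg j) (b : Λ) : S.toGTensor T (x ⊗ₜ a) * S.toGTensor T (y ⊗ₜ b) =
      (-1 : ℂ) ^ (i * j) • S.toGTensor T ((x * y) ⊗ₜ (a * b)) := by
  refine (GradedTensorProduct.tmul_coe_mul_coe_tmul S.deg T.deg x ⟨a, ha⟩ ⟨y, hy⟩ b).trans ?_
  rcases Nat.even_or_odd (i * j) with h | h
  · rw [h.neg_one_pow, one_smul, h.neg_one_pow, one_smul]
  · rw [h.neg_one_pow, h.neg_one_pow, Units.neg_smul, one_smul, neg_one_smul]

lemma toGTensor_mul_toGTensor_of_right_mem_zero (x : Ω) {a : Λ} (ha : a ∈ T.deg 0) (y : Ω)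
    (b : Λ) : S.toGTensor T (x ⊗ₜ a) * S.toGTensor T (y ⊗ₜ b) =
      S.toGTensor T ((x * y) ⊗ₜ (a * b)) := by
  induction y using graded_induction S.deg with
  | h n y hy => rw [toGTensor_mul_toGTensor x ha hy, zero_mul, pow_zero, one_smul]
  | hadd y y' h h' => simp only [TensorProduct.add_tmul, map_add, mul_add, h, h']

lemma toGTensor_mul_toGTensor_of_mem_one (x : Ω) {a : Λ} (ha : a ∈ T.deg 1) {y : Ω}
    (hy : y ∈ S.deg 1) (b : Λ) : S.toGTensor T (x ⊗ₜ a) * S.toGTensor T (y ⊗ₜ b) =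
      -S.toGTensor T ((x * y) ⊗ₜ (a * b)) := by
  rw [toGTensor_mul_toGTensor x ha hy, one_mul, pow_one, neg_one_smul]

lemma toGTensor_one_mul_toGTensor_one {i : ℕ} {a : Λ} (ha : a ∈ T.deg i) (b : Λ) :
    S.toGTensor T (1 ⊗ₜ a) * S.toGTensor T (1 ⊗ₜ b) = S.toGTensor T (1 ⊗ₜ (a * b)) := by
  rw [toGTensor_mul_toGTensor 1 ha SetLike.GradedOne.one_mem, mul_zero, pow_zero, one_smul, one_mul]

variable (S T)

/-- The differential of `Ω ⊗̂ Λ`. -/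
def gTensorD : S.GTensor T →ₗ[ℂ] S.GTensor T := (S.toGTensor T).conj (S.tensorD T)

/-- The grading involution of `Ω ⊗̂ Λ`. -/
def gTensorSgn : S.GTensor T →ₗ[ℂ] S.GTensor T :=
  (S.toGTensor T).conj (TensorProduct.map S.sgn T.sgn)

variable {S T}

@[simp] lemma gTensorD_toGTensor (t : Ω ⊗[ℂ] Λ) :
    S.gTensorD T (S.toGTensor T t) = S.toGTensor T (S.tensorD T t) := rfl

@[simp] lemma gTensorSgn_toGTensor (t : Ω ⊗[ℂ] Λ) :
    S.gTensorSgn T (S.toGTensor T t) = S.toGTensor T (TensorProduct.map S.sgn T.sgn t) := rfl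

lemma tensorD_tmul (x : Ω) (a : Λ) :
    S.tensorD T (x ⊗ₜ a) = S.d x ⊗ₜ a + S.sgn x ⊗ₜ T.d a := rfl

lemma gTensorD_mul_of_mem {p i j : ℕ} {x y : Ω} {a : Λ} (hx : x ∈ S.deg p) (ha : a ∈ T.deg i)
    (hy : y ∈ S.deg j) (b : Λ) :
    S.gTensorD T (S.toGTensor T (x ⊗ₜ a) * S.toGTensor T (y ⊗ₜ b)) =
      S.gTensorD T (S.toGTensor T (x ⊗ₜ a)) * S.toGTensor T (y ⊗ₜ b) +
        S.gTensorSgn T (S.toGTensor T (x ⊗ₜ a)) * S.gTensorD T (S.toGTensor T (y ⊗ₜ b)) := by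
  have hxy := SetLike.mul_mem_graded hx hy
  have hsign : (-1 : ℂ) ^ (i * 2) = 1 := by rw [mul_comm, pow_mul, neg_one_sq, one_pow]
  simp only [toGTensor_mul_toGTensor x ha hy, toGTensor_mul_toGTensor (S.d x) ha hy,
    toGTensor_mul_toGTensor x (T.d_mem i a ha) hy, toGTensor_mul_toGTensor x ha (S.d_mem j y hy),
    map_smul, gTensorD_toGTensor, gTensorSgn_toGTensor, tensorD_tmul, TensorProduct.map_tmul,
    S.sgn_of_mem hx, S.sgn_of_mem hy, S.sgn_of_mem hxy, T.sgn_of_mem ha, S.leibniz p x hx,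
    T.leibniz i a ha, TensorProduct.add_tmul, TensorProduct.tmul_add, ← TensorProduct.smul_tmul',
    TensorProduct.tmul_smul, map_add, smul_add, add_mul, mul_add, smul_mul_assoc, mul_smul_comm,
    smul_smul]
  match_scalars <;> ring_nf
  rw [hsign, one_mul]

theorem gTensorD_mul (u v : S.GTensor T) :
    S.gTensorD T (u * v) = S.gTensorD T u * v + S.gTensorSgn T u * S.gTensorD T v := by
  obtain ⟨s, rfl⟩ := (S.toGTensor T).surjective u
  obtain ⟨t, rfl⟩ := (S.toGTensor T).surjective v
  induction s with
  | zero => simp only [map_zero, zero_mul, add_zero]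
  | add s s' h h' => simp only [map_add, add_mul, h, h']; abel
  | tmul x a =>
  induction t with
  | zero => simp only [map_zero, mul_zero, add_zero]
  | add t t' h h' => simp only [map_add, mul_add, h, h']; abel
  | tmul y b =>
  induction x using graded_induction S.deg with
  | hadd x x' h h' =>
    simp only [TensorProduct.add_tmul, map_add, add_mul, h, h']; abel
  | h p x hx =>
  induction a using graded_induction T.deg with
  | hadd a a' h h' =>
    simp only [TensorProduct.tmul_add, map_add, add_mul, h, h']; abel
  | h i a ha =>
  induction y using graded_induction S.deg with
  | hadd y y' h h' =>
    simp only [TensorProduct.add_tmul, map_add, mul_add, h, h']; abel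
  | h j y hy => exact gTensorD_mul_of_mem hx ha hy b

theorem gTensorD_gTensorD (u : S.GTensor T) : S.gTensorD T (S.gTensorD T u) = 0 := by
  obtain ⟨t, rfl⟩ := (S.toGTensor T).surjective u
  rw [gTensorD_toGTensor, gTensorD_toGTensor, LinearEquiv.map_eq_zero_iff]
  induction t with
  | zero => simp only [map_zero]
  | add x y hx hy => rw [map_add, map_add, hx, hy, add_zero]
  | tmul x a =>
    simp only [tensorD_tmul, map_add, d_d, d_sgn, sgn_sgn, TensorProduct.zero_tmul,
      TensorProduct.tmul_zero, TensorProduct.neg_tmul, zero_add, add_zero,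
      add_neg_cancel]

end GradedTensor

end GDStarAlgebra

namespace BicovariantCalculus

variable {A Γ : Type*} [Ring A] [HopfAlgebra ℂ A] [StarRing A] [StarModule ℂ A]
  [AddCommGroup Γ] [Module ℂ Γ] [Module A Γ] [Module Aᵐᵒᵖ Γ]
  [IsScalarTower ℂ A Γ] [IsScalarTower ℂ Aᵐᵒᵖ Γ] [SMulCommClass A Aᵐᵒᵖ Γ]
  [StarAddMonoid Γ] [StarModule ℂ Γ] (C : BicovariantCalculus A Γ)

namespace Envelope

/-- The projection of the envelope onto its component of degree one, obtained from the
homomorphism to the square-zero extension of `A` by `Γ`. -/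
def toΓ : C.Envelope →ₗ[ℂ] Γ :=
  ((TrivSqZeroExt.sndHom A Γ).restrictScalars ℂ) ∘ₗ
    (lift C (TrivSqZeroExt.inlAlgHom ℂ A Γ) ((TrivSqZeroExt.inrHom A Γ).restrictScalars ℂ)
      (fun a ξ => by ext <;> simp) (fun ξ a => by ext <;> simp)
      (fun t ht => by
        clear ht
        induction t with
        | zero => simp
        | add x y hx hy => rw [map_add, hx, hy, add_zero]
        | tmul a b => simp)).toLinearMap

@[simp] lemma toΓ_ofA (a : A) : toΓ C (ofA C a) = 0 := by simp [toΓ]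

@[simp] lemma toΓ_ofΓ (ξ : Γ) : toΓ C (ofΓ C ξ) = ξ := by simp [toΓ]

@[simp] lemma toΓ_ofΓ_mul_ofΓ (ξ η : Γ) : toΓ C (ofΓ C ξ * ofΓ C η) = 0 := by simp [toΓ]

@[simp] lemma toΓ_dΓ (ξ : Γ) : toΓ C (dΓ C ξ) = 0 := by
  induction ξ using C.induction with
  | h a b => rw [dΓ_smul_d, toΓ_ofΓ_mul_ofΓ]
  | hadd x y hx hy => rw [map_add, map_add, hx, hy, add_zero]

lemma gdStar_d_ofA (a : A) : (gdStar C).d (ofA C a) = ofΓ C (C.d a) := diff_ofA C a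

lemma gdStar_d_ofΓ (ξ : Γ) : (gdStar C).d (ofΓ C ξ) = dΓ C ξ := diff_ofΓ C ξ

lemma ofA_mem_gdStar (a : A) : ofA C a ∈ (gdStar C).deg 0 := ofA_mem C a

lemma ofΓ_mem_gdStar (ξ : Γ) : ofΓ C ξ ∈ (gdStar C).deg 1 := ofΓ_mem C ξ

section LiftDifferential

variable {C} {R : Type*} [Ring R] [Algebra ℂ R] {D : R →ₗ[ℂ] R} {F : A →ₐ[ℂ] R} {G : Γ →ₗ[ℂ] R}
  (hG : ∀ a b, G (a • C.d b) = F a * D (F b))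
  (hD : ∀ a r, D (F a * r) = D (F a) * r + F a * D r) (hDD : ∀ a, D (D (F a)) = 0)

include hG

lemma map_smul_of_map_smul_d (a : A) (ξ : Γ) : G (a • ξ) = F a * G ξ := by
  induction ξ using C.induction with
  | h b c => rw [← mul_smul, hG, hG, map_mul, mul_assoc]
  | hadd x y hx hy => rw [smul_add, map_add, hx, hy, map_add, mul_add]

include hD

lemma map_op_smul_of_map_smul_d (ξ : Γ) (a : A) : G (op a • ξ) = G ξ * F a := by
  induction ξ using C.induction with
  | h b c =>
    have hleibniz : op a • b • C.d c = b • C.d (c * a) - (b * c) • C.d a := by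
      rw [C.leibniz, smul_add, mul_smul, add_sub_cancel_left, ← smul_comm]
    rw [hleibniz, map_sub, hG, hG, hG, map_mul F c a, hD, map_mul F b c]
    noncomm_ring
  | hadd x y hx hy => rw [smul_add, map_add, hx, hy, map_add, add_mul]

include hDD

lemma lift_mul_comp_d (t : A ⊗[ℂ] A) :
    TensorProduct.lift ((LinearMap.mul ℂ R).compl₁₂ (G ∘ₗ C.d) (G ∘ₗ C.d)) t =
      D (G (C.adb t)) := by
  have hGd (a : A) : G (C.d a) = D (F a) := by simpa using hG 1 a
  induction t with
  | zero => simp only [map_zero]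
  | add x y hx hy => simp only [map_add, hx, hy]
  | tmul a b =>
    rw [adb_tmul, hG, hD, hDD, mul_zero, add_zero, TensorProduct.lift.tmul,
      LinearMap.compl₁₂_apply, LinearMap.mul_apply', LinearMap.comp_apply, LinearMap.comp_apply,
      hGd, hGd]

variable (C D F G)

/-- The universal property of the envelope among differential algebras: a homomorphism `F` from
`A` to an algebra with a differential `D` extends as soon as `a d(b) ↦ F(a) D(F(b))` is well
defined. -/
def liftDifferential : C.Envelope →ₐ[ℂ] R :=
  lift C F G (map_smul_of_map_smul_d hG) (map_op_smul_of_map_smul_d hG hD)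
    (fun t ht => by rw [lift_mul_comp_d hG hD hDD, ht, map_zero, map_zero])

lemma liftDifferential_ofΓ (ξ : Γ) : liftDifferential C D F G hG hD hDD (ofΓ C ξ) = G ξ :=
  lift_ofΓ C F G _ _ _ ξ

lemma liftDifferential_dΓ (ξ : Γ) : liftDifferential C D F G hG hD hDD (dΓ C ξ) = D (G ξ) := by
  obtain ⟨t, rfl⟩ := C.adb_surjective ξ
  rw [dΓ_adb, ← lift_mul_comp_d hG hD hDD]
  induction t with
  | zero => simp only [map_zero]
  | add x y hx hy => simp only [map_add, hx, hy]
  | tmul a b =>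
    rw [ddMap_tmul, map_mul, liftDifferential_ofΓ, liftDifferential_ofΓ]
    rfl

end LiftDifferential

end Envelope

open Envelope

/-- The inclusion of the left-invariant part in the envelope. -/
def ofInv : C.inv →ₗ[ℂ] C.Envelope := ofΓ C ∘ₗ C.inv.subtype

lemma ofInv_mem (ϑ : C.inv) : C.ofInv ϑ ∈ (gdStar C).deg 1 := ofΓ_mem_gdStar C ϑ

section Coactions

variable {Ω : Type*} [Ring Ω] [Algebra ℂ Ω] [StarAddMonoid Ω] [StarModule ℂ Ω]
  (S : GDStarAlgebra Ω)

/-- The inclusion of `Ω ⊗ A` in `Ω ⊗̂ Γ^∧`. -/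
def inclA : Ω ⊗[ℂ] A →ₐ[ℂ] S.GTensor (gdStar C) :=
  Algebra.TensorProduct.algHomOfLinearMapTensorProduct
    ((S.toGTensor (gdStar C)).toLinearMap ∘ₗ (ofA C).toLinearMap.lTensor Ω)
    (fun x y a b => by
      simp only [LinearMap.comp_apply, LinearMap.lTensor_tmul, LinearEquiv.coe_coe,
        AlgHom.toLinearMap_apply, map_mul]
      exact (GDStarAlgebra.toGTensor_mul_toGTensor_of_right_mem_zero x (ofA_mem_gdStar C a) y
        _).symm)
    (by
      simp only [LinearMap.comp_apply, LinearMap.lTensor_tmul, AlgHom.toLinearMap_apply, map_one]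
      rfl)

lemma inclA_apply (t : Ω ⊗[ℂ] A) :
    C.inclA S t = S.toGTensor (gdStar C) ((ofA C).toLinearMap.lTensor Ω t) := rfl

lemma gTensorSgn_inclA_rTensor {M : Type*} [AddCommGroup M] [Module ℂ M] {f : M →ₗ[ℂ] Ω}
    (hf : ∀ m, S.sgn (f m) = f m) (t : M ⊗[ℂ] A) :
    S.gTensorSgn (gdStar C) (C.inclA S (f.rTensor A t)) = C.inclA S (f.rTensor A t) := by
  induction t with
  | zero => simp only [map_zero]
  | add t u ht hu => simp only [map_add, ht, hu]
  | tmul m a =>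
    rw [LinearMap.rTensor_tmul, inclA_apply, LinearMap.lTensor_tmul,
      GDStarAlgebra.gTensorSgn_toGTensor, TensorProduct.map_tmul, hf, AlgHom.toLinearMap_apply,
      GDStarAlgebra.sgn_of_mem_zero _ (ofA_mem_gdStar C a)]

lemma gTensorD_inclA (t : Ω ⊗[ℂ] A) :
    S.gTensorD (gdStar C) (C.inclA S t) = C.inclA S (S.d.rTensor A t) +
      S.toGTensor (gdStar C) (TensorProduct.map S.sgn (ofΓ C ∘ₗ C.d) t) := by
  rw [inclA_apply, inclA_apply, GDStarAlgebra.gTensorD_toGTensor, ← map_add]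
  congr 1
  induction t with
  | zero => simp only [map_zero, add_zero]
  | add t u ht hu => simp only [map_add, ht, hu]; abel
  | tmul x a => exact congrArg (S.d x ⊗ₜ ofA C a + S.sgn x ⊗ₜ[ℂ] ·) (gdStar_d_ofA C a)

end Coactions

section Comul

/-- The coproduct of `A`, as a homomorphism to `Γ^∧ ⊗̂ Γ^∧`. -/
def comulHatA : A →ₐ[ℂ] (gdStar C).GTensor (gdStar C) :=
  (C.inclA (gdStar C)).comp
    ((Algebra.TensorProduct.map (ofA C) (AlgHom.id ℂ A)).comp (Bialgebra.comulAlgHom ℂ A))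

/-- The extension of the coproduct to `Γ`, the sum of the right and the left action. -/
def comulHatΓ : Γ →ₗ[ℂ] (gdStar C).GTensor (gdStar C) :=
  (C.inclA (gdStar C)).toLinearMap ∘ₗ (ofΓ C).rTensor A ∘ₗ C.rightAction +
    ((gdStar C).toGTensor (gdStar C)).toLinearMap ∘ₗ
      TensorProduct.map (ofA C).toLinearMap (ofΓ C) ∘ₗ C.leftAction

lemma comulHatA_apply (a : A) :
    C.comulHatA a = C.inclA (gdStar C) ((ofA C).toLinearMap.rTensor A (Coalgebra.comul a)) := rfl

lemma comulHatΓ_apply (ξ : Γ) :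
    C.comulHatΓ ξ = C.inclA (gdStar C) ((ofΓ C).rTensor A (C.rightAction ξ)) +
      (gdStar C).toGTensor (gdStar C)
        (TensorProduct.map (ofA C).toLinearMap (ofΓ C) (C.leftAction ξ)) := rfl

lemma inclA_actL_add_toGTensor_actR (x y : A ⊗[ℂ] A) :
    C.inclA (gdStar C) ((ofΓ C).rTensor A (actL A Γ x (C.d.rTensor A y))) +
      (gdStar C).toGTensor (gdStar C)
        (TensorProduct.map (ofA C).toLinearMap (ofΓ C) (actR A Γ x (C.d.lTensor A y))) =
    C.inclA (gdStar C) ((ofA C).toLinearMap.rTensor A x) *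
      (gdStar C).gTensorD (gdStar C)
        (C.inclA (gdStar C) ((ofA C).toLinearMap.rTensor A y)) := by
  rw [gTensorD_inclA, mul_add]
  congr 1
  · rw [← map_mul]
    congr 1
    induction x with
    | zero => simp only [map_zero, zero_mul, LinearMap.zero_apply]
    | add x x' h h' => simp only [map_add, add_mul, LinearMap.add_apply, h, h']
    | tmul a a' =>
    induction y with
    | zero => simp only [map_zero, mul_zero]
    | add y y' h h' => simp only [map_add, mul_add, h, h']
    | tmul b b' =>
      simp only [LinearMap.rTensor_tmul, actL_tmul, AlgHom.toLinearMap_apply, gdStar_d_ofA,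
        Algebra.TensorProduct.tmul_mul_tmul, ofΓ_smul]
  · induction x with
    | zero => simp only [map_zero, zero_mul, LinearMap.zero_apply]
    | add x x' h h' => simp only [map_add, add_mul, LinearMap.add_apply, h, h']
    | tmul a a' =>
    induction y with
    | zero => simp only [map_zero, mul_zero]
    | add y y' h h' => simp only [map_add, mul_add, h, h']
    | tmul b b' =>
      simp only [LinearMap.rTensor_tmul, LinearMap.lTensor_tmul, actR_tmul,
        AlgHom.toLinearMap_apply, TensorProduct.map_tmul, LinearMap.comp_apply, inclA_apply,
        GDStarAlgebra.toGTensor_mul_toGTensor_of_right_mem_zero _ (ofA_mem_gdStar C a'),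
        GDStarAlgebra.sgn_of_mem_zero _ (ofA_mem_gdStar C b), ofΓ_smul, map_mul]

lemma comulHatΓ_smul_d (a b : A) :
    C.comulHatΓ (a • C.d b) =
      C.comulHatA a * (gdStar C).gTensorD (gdStar C) (C.comulHatA b) := by
  rw [comulHatΓ_apply, C.leftAction_smul_d, C.rightAction_smul_d, inclA_actL_add_toGTensor_actR,
    comulHatA_apply, comulHatA_apply]

lemma gTensorD_comulHatA_mul (a : A) (v : (gdStar C).GTensor (gdStar C)) :
    (gdStar C).gTensorD (gdStar C) (C.comulHatA a * v) =
      (gdStar C).gTensorD (gdStar C) (C.comulHatA a) * v +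
        C.comulHatA a * (gdStar C).gTensorD (gdStar C) v := by
  rw [GDStarAlgebra.gTensorD_mul, comulHatA_apply, C.gTensorSgn_inclA_rTensor (gdStar C)
    fun b => GDStarAlgebra.sgn_of_mem_zero _ (ofA_mem_gdStar C b)]

/-- The extension of the coproduct of `A` to a homomorphism of differential algebras
`Γ^∧ → Γ^∧ ⊗̂ Γ^∧`. -/
def comulHat : C.Envelope →ₐ[ℂ] (gdStar C).GTensor (gdStar C) :=
  liftDifferential C ((gdStar C).gTensorD (gdStar C)) C.comulHatA C.comulHatΓ C.comulHatΓ_smul_d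
    C.gTensorD_comulHatA_mul fun _ => GDStarAlgebra.gTensorD_gTensorD _

lemma comulHat_ofΓ (ξ : Γ) : C.comulHat (ofΓ C ξ) = C.comulHatΓ ξ := liftDifferential_ofΓ ..

lemma comulHat_dΓ (ξ : Γ) :
    C.comulHat (dΓ C ξ) = (gdStar C).gTensorD (gdStar C) (C.comulHatΓ ξ) :=
  liftDifferential_dΓ ..

end Comul

end BicovariantCalculus

section MulMap

variable {k M N R R' : Type*} [CommSemiring k] [AddCommMonoid M] [Module k M] [AddCommMonoid N]
  [Module k N] [Semiring R] [Algebra k R] [Semiring R'] [Algebra k R']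

lemma rTensor_mul_rTensor (f : M →ₗ[k] R) (g : N →ₗ[k] R) (u : M ⊗[k] R') (v : N ⊗[k] R') :
    f.rTensor R' u * g.rTensor R' v =
      (LinearMap.mul' k R ∘ₗ TensorProduct.map f g).rTensor R'
        ((LinearMap.mul' k R').lTensor (M ⊗[k] N)
          (TensorProduct.tensorTensorTensorComm k M R' N R' (u ⊗ₜ v))) := by
  induction u with
  | zero => simp only [map_zero, zero_mul, TensorProduct.zero_tmul]
  | add u u' h h' => simp only [map_add, add_mul, TensorProduct.add_tmul, h, h']
  | tmul x a =>
    induction v with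
    | zero => simp only [map_zero, mul_zero, TensorProduct.tmul_zero]
    | add v v' h h' => simp only [map_add, mul_add, TensorProduct.tmul_add, h, h']
    | tmul y b => simp

end MulMap

namespace BicovariantCalculus

open Envelope

variable {A Γ : Type*} [Ring A] [HopfAlgebra ℂ A] [StarRing A] [StarModule ℂ A]
  [AddCommGroup Γ] [Module ℂ Γ] [Module A Γ] [Module Aᵐᵒᵖ Γ]
  [IsScalarTower ℂ A Γ] [IsScalarTower ℂ Aᵐᵒᵖ Γ] [SMulCommClass A Aᵐᵒᵖ Γ]
  [StarAddMonoid Γ] [StarModule ℂ Γ] (C : BicovariantCalculus A Γ)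

/-- The map `α ⊗ β ↦ ∑ αₖ ⊗ cₖ β - ∑ βₗ ⊗ α dₗ`, where `ϖ(α) = ∑ αₖ ⊗ cₖ` and
`ϖ(β) = ∑ βₗ ⊗ dₗ`, which collects the terms of bidegree `(1, 1)` in the coproduct of `α β`. -/
def mixedTerms : C.inv ⊗[ℂ] C.inv →ₗ[ℂ] C.inv ⊗[ℂ] C.Envelope :=
  (LinearMap.mul' ℂ C.Envelope).lTensor C.inv ∘ₗ
      (TensorProduct.assoc ℂ C.inv C.Envelope C.Envelope).toLinearMap ∘ₗ
      TensorProduct.map ((ofA C).toLinearMap.lTensor C.inv ∘ₗ C.varpi) C.ofInv -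
    (LinearMap.mul' ℂ C.Envelope).lTensor C.inv ∘ₗ
      (TensorProduct.leftComm ℂ C.Envelope C.inv C.Envelope).toLinearMap ∘ₗ
      TensorProduct.map C.ofInv ((ofA C).toLinearMap.lTensor C.inv ∘ₗ C.varpi)

lemma lTensor_proj_lTensor_ofA {M : Type*} [AddCommGroup M] [Module ℂ M] (t : M ⊗[ℂ] A) :
    (proj C).toLinearMap.lTensor M ((ofA C).toLinearMap.lTensor M t) = t := by
  have hproj : (proj C).toLinearMap ∘ₗ (ofA C).toLinearMap = LinearMap.id := by
    ext a
    simp [proj]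
  rw [← LinearMap.lTensor_comp_apply, hproj, LinearMap.lTensor_id, LinearMap.id_apply]

section

variable {Ω : Type*} [Ring Ω] [Algebra ℂ Ω] [StarAddMonoid Ω] [StarModule ℂ Ω]
  (S : GDStarAlgebra Ω)

/-- The map `ϑ ↦ ∑ φ(ϑₖ) ⊗ cₖ`, where `ϖ(ϑ) = ∑ ϑₖ ⊗ cₖ`. -/
def tensorialMap (φ : C.inv →ₗ[ℂ] Ω) : C.inv →ₗ[ℂ] S.GTensor (gdStar C) :=
  (C.inclA S).toLinearMap ∘ₗ φ.rTensor A ∘ₗ C.varpi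

/-- The map `ϑ ↦ ∑ ω(ϑₖ) ⊗ cₖ + 1 ⊗ ϑ`, where `ϖ(ϑ) = ∑ ϑₖ ⊗ cₖ`. -/
def connectionMap (ω : C.inv →ₗ[ℂ] Ω) : C.inv →ₗ[ℂ] S.GTensor (gdStar C) :=
  C.tensorialMap S ω +
    (S.toGTensor (gdStar C)).toLinearMap ∘ₗ TensorProduct.mk ℂ Ω C.Envelope 1 ∘ₗ C.ofInv

lemma tensorialMap_apply (φ : C.inv →ₗ[ℂ] Ω) (ϑ : C.inv) :
    C.tensorialMap S φ ϑ = C.inclA S (φ.rTensor A (C.varpi ϑ)) := rfl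

lemma connectionMap_apply (ω : C.inv →ₗ[ℂ] Ω) (ϑ : C.inv) :
    C.connectionMap S ω ϑ =
      C.tensorialMap S ω ϑ + S.toGTensor (gdStar C) (1 ⊗ₜ C.ofInv ϑ) := rfl

lemma inclA_rTensor_mul_toGTensor_one {M : Type*} [AddCommGroup M] [Module ℂ M] (f : M →ₗ[ℂ] Ω)
    (u : M ⊗[ℂ] A) (ξ : C.Envelope) :
    C.inclA S (f.rTensor A u) * S.toGTensor (gdStar C) (1 ⊗ₜ ξ) =
      S.toGTensor (gdStar C) (f.rTensor C.Envelope ((LinearMap.mul' ℂ C.Envelope).lTensor M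
        (TensorProduct.assoc ℂ M C.Envelope C.Envelope
          ((ofA C).toLinearMap.lTensor M u ⊗ₜ ξ)))) := by
  induction u with
  | zero => simp only [map_zero, zero_mul, TensorProduct.zero_tmul]
  | add u u' h h' => simp only [map_add, add_mul, TensorProduct.add_tmul, h, h']
  | tmul x a =>
    simp [inclA_apply,
      GDStarAlgebra.toGTensor_mul_toGTensor_of_right_mem_zero _ (ofA_mem_gdStar C a)]

lemma toGTensor_one_mul_inclA_rTensor {M : Type*} [AddCommGroup M] [Module ℂ M] {f : M →ₗ[ℂ] Ω}
    (hf : ∀ m, f m ∈ S.deg 1) {ξ : C.Envelope} (hξ : ξ ∈ (gdStar C).deg 1) (u : M ⊗[ℂ] A) :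
    S.toGTensor (gdStar C) (1 ⊗ₜ ξ) * C.inclA S (f.rTensor A u) =
      -S.toGTensor (gdStar C) (f.rTensor C.Envelope ((LinearMap.mul' ℂ C.Envelope).lTensor M
        (TensorProduct.leftComm ℂ C.Envelope M C.Envelope
          (ξ ⊗ₜ (ofA C).toLinearMap.lTensor M u)))) := by
  induction u with
  | zero => simp only [map_zero, mul_zero, TensorProduct.tmul_zero, neg_zero]
  | add u u' h h' => simp only [map_add, mul_add, TensorProduct.tmul_add, h, h', neg_add]
  | tmul x a =>
    simp [inclA_apply, GDStarAlgebra.toGTensor_mul_toGTensor_of_mem_one _ hξ (hf x)]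

lemma connectionMap_mul_connectionMap {ω : C.inv →ₗ[ℂ] Ω} (hω : ∀ ϑ, ω ϑ ∈ S.deg 1)
    (α β : C.inv) :
    C.connectionMap S ω α * C.connectionMap S ω β =
      C.inclA S ((LinearMap.mul' ℂ Ω ∘ₗ TensorProduct.map ω ω).rTensor A (C.varpi₂ (α ⊗ₜ β))) +
        S.toGTensor (gdStar C) (ω.rTensor C.Envelope (C.mixedTerms (α ⊗ₜ β))) +
        S.toGTensor (gdStar C) (1 ⊗ₜ (C.ofInv α * C.ofInv β)) := by
  rw [connectionMap_apply, connectionMap_apply, add_mul, mul_add, mul_add, tensorialMap_apply,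
    tensorialMap_apply, ← map_mul, rTensor_mul_rTensor, inclA_rTensor_mul_toGTensor_one,
    C.toGTensor_one_mul_inclA_rTensor S hω (C.ofInv_mem α),
    GDStarAlgebra.toGTensor_one_mul_toGTensor_one (C.ofInv_mem α)]
  simp only [mixedTerms, varpi₂, LinearMap.sub_apply, LinearMap.comp_apply, TensorProduct.map_tmul,
    map_sub, LinearEquiv.coe_coe]
  abel

lemma mul'_map_connectionMap {ω : C.inv →ₗ[ℂ] Ω} (hω : ∀ ϑ, ω ϑ ∈ S.deg 1)
    (z : C.inv ⊗[ℂ] C.inv) :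
    LinearMap.mul' ℂ _ (TensorProduct.map (C.connectionMap S ω) (C.connectionMap S ω) z) =
      C.inclA S ((LinearMap.mul' ℂ Ω ∘ₗ TensorProduct.map ω ω).rTensor A (C.varpi₂ z)) +
        S.toGTensor (gdStar C) (ω.rTensor C.Envelope (C.mixedTerms z)) +
        S.toGTensor (gdStar C)
          (1 ⊗ₜ LinearMap.mul' ℂ C.Envelope (TensorProduct.map C.ofInv C.ofInv z)) := by
  induction z with
  | zero => simp only [map_zero, TensorProduct.tmul_zero, add_zero]
  | add x y hx hy => simp only [map_add, hx, hy, TensorProduct.tmul_add]; abel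
  | tmul α β => exact C.connectionMap_mul_connectionMap S hω α β

lemma gTensorD_connectionMap {ω : C.inv →ₗ[ℂ] Ω} (hω : ∀ ϑ, ω ϑ ∈ S.deg 1) (ϑ : C.inv) :
    S.gTensorD (gdStar C) (C.connectionMap S ω ϑ) =
      C.tensorialMap S (S.d ∘ₗ ω) ϑ -
        S.toGTensor (gdStar C) (TensorProduct.map ω (ofΓ C ∘ₗ C.d) (C.varpi ϑ)) +
        S.toGTensor (gdStar C) (1 ⊗ₜ (gdStar C).d (C.ofInv ϑ)) := by
  have hsgn : TensorProduct.map (S.sgn ∘ₗ ω) (ofΓ C ∘ₗ C.d) =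
      -TensorProduct.map ω (ofΓ C ∘ₗ C.d) := by
    rw [show S.sgn ∘ₗ ω = -ω from LinearMap.ext fun ϑ => S.sgn_of_mem_one (hω ϑ),
      ← LinearMap.rTensor_comp_lTensor, LinearMap.rTensor_neg, LinearMap.neg_comp,
      LinearMap.rTensor_comp_lTensor]
  rw [connectionMap_apply, map_add, tensorialMap_apply, gTensorD_inclA,
    GDStarAlgebra.gTensorD_toGTensor, GDStarAlgebra.tensorD_tmul, S.d_one, S.sgn_one,
    TensorProduct.zero_tmul, zero_add, tensorialMap_apply, LinearMap.rTensor_comp_apply,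
    LinearMap.map_rTensor, hsgn, LinearMap.neg_apply, map_neg, sub_eq_add_neg]

end

lemma comulHat_ofInv (ϑ : C.inv) :
    C.comulHat (C.ofInv ϑ) = C.connectionMap (gdStar C) C.ofInv ϑ := by
  rw [ofInv, LinearMap.comp_apply, Submodule.subtype_apply, comulHat_ofΓ, comulHatΓ_apply,
    C.mem_inv.1 ϑ.2, ← C.rTensor_varpi, TensorProduct.map_tmul, AlgHom.toLinearMap_apply, map_one,
    ← LinearMap.rTensor_comp_apply]
  rfl

lemma comulHat_mul'_map_ofInv (z : C.inv ⊗[ℂ] C.inv) :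
    C.comulHat (LinearMap.mul' ℂ C.Envelope (TensorProduct.map C.ofInv C.ofInv z)) =
      LinearMap.mul' ℂ _ (TensorProduct.map (C.connectionMap (gdStar C) C.ofInv)
        (C.connectionMap (gdStar C) C.ofInv) z) := by
  have hconn : C.comulHat.toLinearMap ∘ₗ C.ofInv = C.connectionMap (gdStar C) C.ofInv :=
    LinearMap.ext C.comulHat_ofInv
  rw [← hconn]
  exact LinearMap.congr_fun (algHom_comp_mul'_comp_map C.comulHat C.ofInv C.ofInv) z

lemma toΓ_comp_mul'_comp_map_ofInv :
    toΓ C ∘ₗ LinearMap.mul' ℂ C.Envelope ∘ₗ TensorProduct.map C.ofInv C.ofInv = 0 := by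
  ext α β
  exact toΓ_ofΓ_mul_ofΓ C α β

/-- The component of bidegree `(1, 1)` of the identity obtained by applying the coproduct to
`d(ϑ) = ∑ ϑ¹ ϑ²`. -/
lemma mixedTerms_eq_neg_lTensor_varpi {ϑ : C.inv} {z : C.inv ⊗[ℂ] C.inv}
    (hz : LinearMap.mul' ℂ C.Envelope (TensorProduct.map C.ofInv C.ofInv z) =
      (gdStar C).d (C.ofInv ϑ)) :
    C.mixedTerms z = -(ofΓ C ∘ₗ C.d).lTensor C.inv (C.varpi ϑ) := by
  have hdiff : C.comulHat ((gdStar C).d (C.ofInv ϑ)) =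
      (gdStar C).gTensorD (gdStar C) (C.connectionMap (gdStar C) C.ofInv ϑ) := by
    rw [← comulHat_ofInv, ofInv, LinearMap.comp_apply, gdStar_d_ofΓ, comulHat_dΓ, comulHat_ofΓ]
  have hsubtype : toΓ C ∘ₗ C.ofInv = C.inv.subtype := LinearMap.ext fun α => toΓ_ofΓ C α
  have hd : toΓ C ∘ₗ (gdStar C).d ∘ₗ C.ofInv = 0 := LinearMap.ext fun α => by
    rw [LinearMap.comp_apply, LinearMap.comp_apply, ofInv, LinearMap.comp_apply, gdStar_d_ofΓ,
      toΓ_dΓ, LinearMap.zero_apply]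
  rw [← hz, comulHat_mul'_map_ofInv, C.mul'_map_connectionMap (gdStar C) C.ofInv_mem,
    C.gTensorD_connectionMap (gdStar C) C.ofInv_mem, hz, add_left_inj, tensorialMap_apply,
    inclA_apply, inclA_apply, ← map_add, ← map_sub, EmbeddingLike.apply_eq_iff_eq] at hdiff
  refine Module.Flat.rTensor_preserves_injective_linearMap C.inv.subtype
    C.inv.injective_subtype ?_
  have hproj := congrArg ((toΓ C).rTensor C.Envelope) hdiff
  rw [map_add, map_sub, ← LinearMap.comp_apply (LinearMap.lTensor _ _),
    ← LinearMap.comp_apply (LinearMap.lTensor _ _), LinearMap.lTensor_comp_rTensor,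
    LinearMap.lTensor_comp_rTensor, LinearMap.rTensor_map, LinearMap.rTensor_map,
    LinearMap.rTensor_map, toΓ_comp_mul'_comp_map_ofInv, hd, ← LinearMap.rTensor_comp_apply,
    hsubtype, TensorProduct.map_zero_left, TensorProduct.map_zero_left, LinearMap.zero_apply,
    LinearMap.zero_apply, zero_add, zero_sub] at hproj
  rw [hproj, map_neg, ← LinearMap.comp_apply (LinearMap.rTensor _ _),
    LinearMap.rTensor_comp_lTensor]

variable {C} {Ω : Type*} [Ring Ω] [Algebra ℂ Ω] [StarAddMonoid Ω] [StarModule ℂ Ω]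
  (S : GDStarAlgebra Ω)

lemma gTensorD_connectionMap_sub_mul'_map_connectionMap [HopfStarAlgebra A]
    (δ : EmbeddedDifferential C) {ω : C.inv →ₗ[ℂ] Ω} (hω : ∀ ϑ, ω ϑ ∈ S.deg 1) (ϑ : C.inv) :
    S.gTensorD (gdStar C) (C.connectionMap S ω ϑ) -
        LinearMap.mul' ℂ _ (TensorProduct.map (C.connectionMap S ω) (C.connectionMap S ω) (δ.δ ϑ)) =
      C.tensorialMap S
        (S.d ∘ₗ ω - LinearMap.mul' ℂ Ω ∘ₗ TensorProduct.map ω ω ∘ₗ δ.δ) ϑ := by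
  have hlifts : LinearMap.mul' ℂ C.Envelope (TensorProduct.map C.ofInv C.ofInv (δ.δ ϑ)) =
      (gdStar C).d (C.ofInv ϑ) := δ.lifts ϑ
  rw [C.gTensorD_connectionMap S hω, C.mul'_map_connectionMap S hω, hlifts,
    C.mixedTerms_eq_neg_lTensor_varpi hlifts, ← δ.intertwines, map_neg, map_neg,
    ← LinearMap.comp_apply (LinearMap.rTensor _ ω), LinearMap.rTensor_comp_lTensor,
    ← LinearMap.rTensor_comp_apply, LinearMap.comp_assoc, tensorialMap_apply, tensorialMap_apply,
    LinearMap.rTensor_sub, LinearMap.sub_apply, map_sub]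
  abel

end BicovariantCalculus

section StarTensor

variable {M N A : Type*} [AddCommGroup M] [Module ℂ M] [StarAddMonoid M] [StarModule ℂ M]
  [AddCommGroup N] [Module ℂ N] [StarAddMonoid N] [StarModule ℂ N]
  [AddCommGroup A] [Module ℂ A] [StarAddMonoid A] [StarModule ℂ A]

lemma rTensor_star {f : M →ₗ[ℂ] N} (hf : ∀ m, f (star m) = star (f m)) (u : M ⊗[ℂ] A) :
    f.rTensor A (star u) = star (f.rTensor A u) := by
  induction u with
  | zero => simp only [star_zero, map_zero]
  | add u u' h h' => simp only [map_add, star_add, h, h']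
  | tmul x a =>
    rw [TensorProduct.star_tmul, LinearMap.rTensor_tmul, LinearMap.rTensor_tmul,
      TensorProduct.star_tmul, hf]

end StarTensor

namespace BicovariantCalculus

variable {A Γ : Type*} [Ring A] [HopfAlgebra ℂ A] [StarRing A] [StarModule ℂ A]
  [AddCommGroup Γ] [Module ℂ Γ] [Module A Γ] [Module Aᵐᵒᵖ Γ]
  [IsScalarTower ℂ A Γ] [IsScalarTower ℂ Aᵐᵒᵖ Γ] [SMulCommClass A Aᵐᵒᵖ Γ]
  [StarAddMonoid Γ] [StarModule ℂ Γ] (C : BicovariantCalculus A Γ)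

lemma star_smul_d_eq_sub (a b : A) :
    star (a • C.d b) = C.d (star b * star a) - star b • C.d (star a) := by
  rw [C.star_smul_d, C.leibniz, add_sub_cancel_left]

lemma star_actL (x y : A ⊗[ℂ] A) :
    star (actL A Γ x (C.d.rTensor A y)) =
      C.d.rTensor A (star y * star x) - actL A Γ (star y) (C.d.rTensor A (star x)) := by
  induction x with
  | zero => simp only [map_zero, LinearMap.zero_apply, star_zero, mul_zero, sub_zero]
  | add x x' h h' =>
    simp only [map_add, LinearMap.add_apply, star_add, h, h', mul_add]
    abel
  | tmul a a' =>
    induction y with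
    | zero =>
      simp only [map_zero, LinearMap.zero_apply, star_zero, zero_mul, sub_zero]
    | add y y' h h' =>
      simp only [map_add, LinearMap.add_apply, star_add, h, h', add_mul]
      abel
    | tmul b b' =>
      simp only [LinearMap.rTensor_tmul, actL_tmul, TensorProduct.star_tmul,
        Algebra.TensorProduct.tmul_mul_tmul, ← TensorProduct.sub_tmul, star_smul_d_eq_sub,
        star_mul]

lemma rightAction_d (a : A) : C.rightAction (C.d a) = C.d.rTensor A (Coalgebra.comul a) := by
  rw [← one_smul A (C.d a), C.rightAction_smul_d, Bialgebra.comul_one,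
    Algebra.TensorProduct.one_def]
  generalize C.d.rTensor A _ = z
  induction z with
  | zero => rw [map_zero]
  | add z z' h h' => rw [map_add, h, h']
  | tmul ξ b => rw [actL_tmul, one_smul, one_mul]

variable [HopfStarAlgebra A]

lemma rightAction_star (ξ : Γ) : C.rightAction (star ξ) = star (C.rightAction ξ) := by
  induction ξ using C.induction with
  | hadd x y hx hy => simp only [star_add, map_add, hx, hy]
  | h a b =>
    rw [star_smul_d_eq_sub, map_sub, rightAction_d, C.rightAction_smul_d, C.rightAction_smul_d,
      star_actL, Bialgebra.comul_mul, HopfStarAlgebra.comul_star, HopfStarAlgebra.comul_star]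

lemma varpi_star (ϑ : C.inv) : C.varpi (star ϑ) = star (C.varpi ϑ) := by
  apply C.inv_rTensor_injective
  rw [C.rTensor_varpi, coe_star_inv, rightAction_star, ← C.rTensor_varpi,
    rTensor_star (f := C.inv.subtype) C.coe_star_inv]

lemma varpiT_star (x : TensorAlgebra ℂ C.inv) : C.varpiT (star x) = star (C.varpiT x) := by
  have hι (ϑ : C.inv) :
      C.varpiT (star (TensorAlgebra.ι ℂ ϑ)) = star (C.varpiT (TensorAlgebra.ι ℂ ϑ)) := by
    change C.varpiT (tensorStar _) = _
    rw [tensorStar_ι, varpiT, TensorAlgebra.lift_ι_apply, TensorAlgebra.lift_ι_apply,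
      LinearMap.comp_apply, LinearMap.comp_apply, varpi_star,
      rTensor_star fun m => (tensorStar_ι m).symm]
  induction x using TensorAlgebra.induction with
  | algebraMap r =>
    rw [← algebraMap_star_comm, AlgHom.commutes, AlgHom.commutes, algebraMap_star_comm]
  | ι m => exact hι m
  | add x y hx hy => rw [star_add, map_add, map_add, star_add, hx, hy]
  | mul x y hx hy => rw [star_mul, map_mul, map_mul, star_mul, hx, hy]

lemma tensorStar_mem_invariants {x : TensorAlgebra ℂ C.inv} (hx : x ∈ C.invariants) :
    tensorStar x ∈ C.invariants := by
  have hinv : C.varpiT x = x ⊗ₜ 1 := hx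
  change C.varpiT (star x) = star x ⊗ₜ 1
  rw [varpiT_star, hinv, TensorProduct.star_tmul, star_one]

end BicovariantCalculus

namespace BundleCalculus

open BicovariantCalculus BicovariantCalculus.Envelope

section Bracket

variable {A Γ Ω : Type*} [Ring A] [HopfAlgebra ℂ A] [StarRing A] [StarModule ℂ A]
  [AddCommGroup Γ] [Module ℂ Γ] [Module A Γ] [Module Aᵐᵒᵖ Γ]
  [IsScalarTower ℂ A Γ] [IsScalarTower ℂ Aᵐᵒᵖ Γ] [SMulCommClass A Aᵐᵒᵖ Γ]
  [StarAddMonoid Γ] [StarModule ℂ Γ] {C : BicovariantCalculus A Γ} [HopfStarAlgebra A]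
  [Ring Ω] [Algebra ℂ Ω] {δ : EmbeddedDifferential C} {I : TwoSidedIdeal Ω}
  {φ ψ : C.inv →ₗ[ℂ] Ω}

lemma bracket_add_left (φ φ' ψ : C.inv →ₗ[ℂ] Ω) :
    bracket δ (φ + φ') ψ = bracket δ φ ψ + bracket δ φ' ψ := by
  simp only [bracket, TensorProduct.map_add_left, LinearMap.add_comp, LinearMap.comp_add]

lemma bracket_add_right (φ ψ ψ' : C.inv →ₗ[ℂ] Ω) :
    bracket δ φ (ψ + ψ') = bracket δ φ ψ + bracket δ φ ψ' := by
  simp only [bracket, TensorProduct.map_add_right, LinearMap.add_comp, LinearMap.comp_add]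

lemma algHom_comp_bracket {R : Type*} [Ring R] [Algebra ℂ R] (e : Ω →ₐ[ℂ] R)
    (φ ψ : C.inv →ₗ[ℂ] Ω) : e.toLinearMap ∘ₗ bracket δ φ ψ =
      bracket δ (e.toLinearMap ∘ₗ φ) (e.toLinearMap ∘ₗ ψ) :=
  congrArg (· ∘ₗ δ.δ) (algHom_comp_mul'_comp_map e φ ψ)

lemma bracket_mem_left (hφ : ∀ ϑ, φ ϑ ∈ I) (ψ : C.inv →ₗ[ℂ] Ω) (ϑ : C.inv) :
    bracket δ φ ψ ϑ ∈ I := by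
  simp only [bracket, LinearMap.comp_apply]
  induction δ.δ ϑ with
  | zero => simp only [map_zero, I.zero_mem]
  | add x y hx hy => simp only [map_add]; exact I.add_mem hx hy
  | tmul α β => exact I.mul_mem_right _ _ (hφ α)

lemma bracket_mem_right (φ : C.inv →ₗ[ℂ] Ω) (hψ : ∀ ϑ, ψ ϑ ∈ I) (ϑ : C.inv) :
    bracket δ φ ψ ϑ ∈ I := by
  simp only [bracket, LinearMap.comp_apply]
  induction δ.δ ϑ with
  | zero => simp only [map_zero, I.zero_mem]
  | add x y hx hy => simp only [map_add]; exact I.add_mem hx hy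
  | tmul α β => exact I.mul_mem_left _ _ (hψ β)

end Bracket

variable {A Γ V B Ω : Type*} [Ring A] [HopfAlgebra ℂ A] [StarRing A] [StarModule ℂ A]
  [AddCommGroup Γ] [Module ℂ Γ] [Module A Γ] [Module Aᵐᵒᵖ Γ]
  [IsScalarTower ℂ A Γ] [IsScalarTower ℂ Aᵐᵒᵖ Γ] [SMulCommClass A Aᵐᵒᵖ Γ]
  [StarAddMonoid Γ] [StarModule ℂ Γ]
  [Ring V] [Algebra ℂ V] [StarRing V] [StarModule ℂ V]
  [Ring B] [Algebra ℂ B] [StarRing B] [StarModule ℂ B]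
  {C : BicovariantCalculus A Γ} {P : QuantumPrincipalBundle A V B}
  [Ring Ω] [Algebra ℂ Ω] [StarAddMonoid Ω] [StarModule ℂ Ω] {X : BundleCalculus C P Ω}
  {φ ψ ω τ : C.inv →ₗ[ℂ] Ω}

lemma toGTensor_hatF (x : Ω) : X.gd.toGTensor (gdStar C) (X.hatF x) = X.action x := rfl

lemma action_gd_d (x : Ω) : X.action (X.gd.d x) = X.gd.gTensorD (gdStar C) (X.action x) :=
  (LinearEquiv.symm_apply_eq _).1 (X.action_d x)

lemma baseForms_le_hor : Subalgebra.toSubmodule X.baseForms ≤ X.hor := fun x hx =>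
  ⟨x ⊗ₜ 1, by rw [X.mem_baseForms.1 hx, LinearMap.lTensor_tmul, AlgHom.toLinearMap_apply, map_one]⟩

lemma cls_eq_cls {x y : X.cocycles} (h : ∃ η ∈ X.baseForms, (x : Ω) - y = X.gd.d η) :
    X.cls x = X.cls y := by
  obtain ⟨η, hη, hd⟩ := h
  exact Ideal.Quotient.eq.2 ⟨η, hη, hd.symm⟩

section Tensorial

variable (X) in
/-- A linear map `φ : Γ_inv → Ω(P)` is tensorial if `F̂ φ = (φ ⊗ id) ϖ`. For a form that takes
horizontal values this is the same as being pseudotensorial, a condition on `F^∧ φ` only. -/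
def IsTensorial (φ : C.inv →ₗ[ℂ] Ω) : Prop :=
  ∀ ϑ, X.action (φ ϑ) = C.tensorialMap X.gd φ ϑ

lemma IsTensorial.isPseudotensorial (hφ : X.IsTensorial φ) {n : ℕ}
    (hdeg : ∀ ϑ, φ ϑ ∈ X.gd.deg n) : X.IsPseudotensorial n φ where
  deg_mem := hdeg
  wedgeF ϑ := by
    have hhatF : X.hatF (φ ϑ) = (ofA C).toLinearMap.lTensor Ω (φ.rTensor A (C.varpi ϑ)) :=
      (X.gd.toGTensor (gdStar C)).injective (hφ ϑ)
    rw [BundleCalculus.wedgeF, LinearMap.comp_apply, hhatF, lTensor_proj_lTensor_ofA]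

lemma IsTensorial.action_lift (hφ : X.IsTensorial φ) (x : TensorAlgebra ℂ C.inv) :
    X.action (TensorAlgebra.lift ℂ φ x) =
      C.inclA X.gd ((TensorAlgebra.lift ℂ φ).toLinearMap.rTensor A (C.varpiT x)) := by
  suffices h : X.action.comp (TensorAlgebra.lift ℂ φ) = (C.inclA X.gd).comp
      ((Algebra.TensorProduct.map (TensorAlgebra.lift ℂ φ) (AlgHom.id ℂ A)).comp C.varpiT) from
    DFunLike.congr_fun h x
  ext ϑ
  have hι : (TensorAlgebra.lift ℂ φ).toLinearMap ∘ₗ TensorAlgebra.ι ℂ = φ := by ext; simp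
  simp only [LinearMap.comp_apply, AlgHom.toLinearMap_apply, AlgHom.comp_apply,
    TensorAlgebra.lift_ι_apply, varpiT, hφ ϑ, tensorialMap_apply]
  conv_lhs => rw [← hι, LinearMap.rTensor_comp_apply]
  rfl

lemma IsTensorial.action_derivationAlong (hφ : X.IsTensorial φ) (hψ : X.IsTensorial ψ)
    (x : TensorAlgebra ℂ C.inv) : X.action (derivationAlong φ ψ x) =
      C.inclA X.gd ((derivationAlong φ ψ).rTensor A (C.varpiT x)) := by
  suffices h : X.action.toLinearMap ∘ₗ derivationAlong φ ψ =
      (C.inclA X.gd).toLinearMap ∘ₗ (derivationAlong φ ψ).rTensor A ∘ₗ C.varpiT.toLinearMap from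
    DFunLike.congr_fun h x
  rw [algHom_comp_derivationAlong]
  refine (eq_derivationAlong (fun ϑ => ?_) fun x y => ?_).symm
  · have hι : derivationAlong φ ψ ∘ₗ TensorAlgebra.ι ℂ = ψ := by ext; simp
    simp only [LinearMap.comp_apply, AlgHom.toLinearMap_apply, varpiT, TensorAlgebra.lift_ι_apply,
      ← LinearMap.rTensor_comp_apply, hι, hψ ϑ, tensorialMap_apply]
  · simp only [LinearMap.comp_apply, AlgHom.toLinearMap_apply, ← algHom_lift_apply,
      hφ.action_lift, map_mul, rTensor_derivationAlong_mul, map_add]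

lemma mem_baseForms_of_action_eq {f : TensorAlgebra ℂ C.inv →ₗ[ℂ] Ω}
    (hf : ∀ x, X.action (f x) = C.inclA X.gd (f.rTensor A (C.varpiT x)))
    {x : TensorAlgebra ℂ C.inv} (hx : x ∈ C.invariants) : f x ∈ X.baseForms := by
  have hinv : C.varpiT x = x ⊗ₜ 1 := hx
  refine (hf x).trans ?_
  rw [hinv, inclA_apply, LinearMap.rTensor_tmul, LinearMap.lTensor_tmul, AlgHom.toLinearMap_apply,
    map_one]
  rfl

end Tensorial

variable [HopfStarAlgebra A]

lemma IsConnection.action (hω : X.IsConnection ω) (ϑ : C.inv) :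
    X.action (ω ϑ) = C.connectionMap X.gd ω ϑ := by
  rw [← toGTensor_hatF, hω.hatF, map_add, ← LinearMap.lTensor_comp_rTensor]
  rfl

lemma IsConnection.isPseudotensorial (hω : X.IsConnection ω) : X.IsPseudotensorial 1 ω where
  deg_mem := hω.deg_one
  wedgeF ϑ := by
    have hΓ : (proj C).toLinearMap.lTensor Ω ((1 : Ω) ⊗ₜ ofΓ C ϑ) = 0 := by simp [proj]
    rw [BundleCalculus.wedgeF, LinearMap.comp_apply, hω.hatF, map_add, hΓ, add_zero,
      ← LinearMap.lTensor_comp_rTensor, LinearMap.comp_apply, lTensor_proj_lTensor_ofA]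

lemma IsConnection.isTensorial_sub (hτ : X.IsConnection τ) (hω : X.IsConnection ω) :
    X.IsTensorial (τ - ω) := by
  intro ϑ
  rw [LinearMap.sub_apply, map_sub, hτ.action, hω.action, connectionMap_apply, connectionMap_apply,
    add_sub_add_right_eq_sub, tensorialMap_apply, tensorialMap_apply, tensorialMap_apply,
    LinearMap.rTensor_sub, LinearMap.sub_apply, map_sub]

variable {δ : EmbeddedDifferential C}

lemma IsPseudotensorial.bracket_sub_mem {n : ℕ} (hφ : X.IsPseudotensorial n φ) (ϑ : C.inv) :
    bracket δ ω φ ϑ - (-1 : ℂ) ^ n • bracket δ φ ω ϑ ∈ X.idealK δ ω :=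
  TwoSidedIdeal.subset_span ⟨n, φ, ϑ, hφ, rfl⟩

lemma IsConnection.bracket_self_mem (hω : X.IsConnection ω) (ϑ : C.inv) :
    bracket δ ω ω ϑ ∈ X.idealK δ ω := by
  have htwo := hω.isPseudotensorial.bracket_sub_mem (δ := δ) (ω := ω) ϑ
  rw [pow_one, neg_one_smul, sub_neg_eq_add, ← two_smul ℂ] at htwo
  have hhalf := TwoSidedIdeal.mul_mem_left _ (algebraMap ℂ Ω 2⁻¹) _ htwo
  rwa [← Algebra.smul_def, inv_smul_smul₀ two_ne_zero] at hhalf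

section Curvature

lemma IsConnection.curvature_mem_deg_two (hω : X.IsConnection ω) (ϑ : C.inv) :
    X.curvature δ ω ϑ ∈ X.gd.deg 2 :=
  sub_mem (X.gd.d_mem 1 _ (hω.deg_one ϑ)) (X.gd.mul'_map_mem_deg_two hω.deg_one _)

lemma IsConnection.sgn_curvature (hω : X.IsConnection ω) (ϑ : C.inv) :
    X.gd.sgn (X.curvature δ ω ϑ) = X.curvature δ ω ϑ := by
  rw [X.gd.sgn_of_mem (hω.curvature_mem_deg_two ϑ), neg_one_sq, one_smul]

lemma IsConnection.curvature_isTensorial (hω : X.IsConnection ω) :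
    X.IsTensorial (X.curvature δ ω) := by
  intro ϑ
  have haction : X.action.toLinearMap ∘ₗ ω = C.connectionMap X.gd ω := LinearMap.ext hω.action
  have hbracket : X.action (bracket δ ω ω ϑ) = LinearMap.mul' ℂ _ (TensorProduct.map
      (C.connectionMap X.gd ω) (C.connectionMap X.gd ω) (δ.δ ϑ)) := by
    rw [← haction]
    exact DFunLike.congr_fun (algHom_comp_mul'_comp_map X.action ω ω) (δ.δ ϑ)
  rw [curvature, LinearMap.sub_apply, map_sub, LinearMap.comp_apply, action_gd_d, hω.action,
    hbracket, gTensorD_connectionMap_sub_mul'_map_connectionMap X.gd δ hω.deg_one]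
  rfl

lemma IsConnection.curvature_star (hω : X.IsConnection ω) (ϑ : C.inv) :
    X.curvature δ ω (star ϑ) = star (X.curvature δ ω ϑ) := by
  simp only [curvature, bracket, LinearMap.sub_apply, LinearMap.comp_apply, star_sub, δ.hermitian,
    X.gd.star_mul'_map hω.deg_one hω.hermitian, hω.hermitian, X.gd.star_d]

lemma IsConnection.bianchi_identity (hω : X.IsConnection ω) (ϑ : C.inv) :
    X.gd.d (X.curvature δ ω ϑ) =
      bracket δ ω (X.curvature δ ω) ϑ - bracket δ (X.curvature δ ω) ω ϑ +
        (bracket δ ω (bracket δ ω ω) ϑ - bracket δ (bracket δ ω ω) ω ϑ) := by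
  have hdω : X.gd.d ∘ₗ ω = X.curvature δ ω + bracket δ ω ω := (sub_add_cancel _ _).symm
  have hdbracket : X.gd.d (bracket δ ω ω ϑ) =
      bracket δ (X.gd.d ∘ₗ ω) ω ϑ - bracket δ ω (X.gd.d ∘ₗ ω) ϑ :=
    X.gd.d_mul'_map hω.deg_one ω (δ.δ ϑ)
  conv_lhs => rw [curvature, LinearMap.sub_apply, map_sub, LinearMap.comp_apply, X.gd.d_d,
    hdbracket, hdω, bracket_add_left, bracket_add_right, LinearMap.add_apply, LinearMap.add_apply]
  abel

lemma IsConnection.d_curvature_mem (hω : X.IsConnection ω) (ϑ : C.inv) :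
    X.gd.d (X.curvature δ ω ϑ) ∈ X.idealK δ ω := by
  have hR : X.IsPseudotensorial 2 (X.curvature δ ω) :=
    hω.curvature_isTensorial.isPseudotensorial hω.curvature_mem_deg_two
  rw [hω.bianchi_identity]
  refine TwoSidedIdeal.add_mem _ ?_ (TwoSidedIdeal.sub_mem _
    (bracket_mem_right ω hω.bracket_self_mem ϑ) (bracket_mem_left hω.bracket_self_mem ω ϑ))
  simpa only [neg_one_sq, one_smul] using hR.bracket_sub_mem (δ := δ) (ω := ω) ϑ

end Curvature

section WeilForm

variable {x : TensorAlgebra ℂ C.inv}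

lemma IsConnection.weilForm_mem_baseForms (hω : X.IsConnection ω) (hx : x ∈ C.invariants) :
    X.weilForm δ ω x ∈ X.baseForms :=
  mem_baseForms_of_action_eq (f := (X.weilForm δ ω).toLinearMap)
    hω.curvature_isTensorial.action_lift hx

lemma IsConnection.d_weilForm_eq_zero (hω : X.IsConnection ω) (hsplit : X.Splitting δ ω)
    (hx : x ∈ C.invariants) : X.gd.d (X.weilForm δ ω x) = 0 :=
  hsplit _ (baseForms_le_hor (X.d_mem_baseForms (hω.weilForm_mem_baseForms hx)))
    (X.gd.d_lift_mem _ hω.sgn_curvature hω.d_curvature_mem x)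

lemma IsConnection.weilForm_mem_cocycles (hω : X.IsConnection ω) (hsplit : X.Splitting δ ω)
    (hx : x ∈ C.invariants) : X.weilForm δ ω x ∈ X.cocycles :=
  ⟨hω.weilForm_mem_baseForms hx, hω.d_weilForm_eq_zero hsplit hx⟩

lemma IsConnection.weilForm_tensorStar (hω : X.IsConnection ω) (x : TensorAlgebra ℂ C.inv) :
    X.weilForm δ ω (tensorStar x) = star (X.weilForm δ ω x) :=
  (X.gd.star_lift hω.sgn_curvature hω.curvature_star x).symm

variable (δ) in
/-- The Weil homomorphism `ϑ ↦ [W^ω(ϑ)]` defined by a single connection. -/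
def IsConnection.weilHom (hω : X.IsConnection ω) (hsplit : X.Splitting δ ω) :
    C.invariants →ₐ[ℂ] X.Cohomology :=
  X.cls.comp (((X.weilForm δ ω).comp C.invariants.val).codRestrict X.cocycles
    fun ϑ => hω.weilForm_mem_cocycles hsplit ϑ.2)

lemma IsConnection.weilHom_tensorStar (hω : X.IsConnection ω) (hsplit : X.Splitting δ ω)
    (ϑ : C.invariants) :
    hω.weilHom δ hsplit ⟨tensorStar (ϑ : TensorAlgebra ℂ C.inv), C.tensorStar_mem_invariants ϑ.2⟩ =
      X.starH (hω.weilHom δ hsplit ϑ) :=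
  congrArg X.cls (Subtype.ext (hω.weilForm_tensorStar ϑ))

end WeilForm

end BundleCalculus

namespace BundleCalculus

open Polynomial BicovariantCalculus

variable {A Γ V B Ω : Type*} [Ring A] [HopfAlgebra ℂ A] [StarRing A] [StarModule ℂ A]
  [HopfStarAlgebra A] [AddCommGroup Γ] [Module ℂ Γ] [Module A Γ] [Module Aᵐᵒᵖ Γ]
  [IsScalarTower ℂ A Γ] [IsScalarTower ℂ Aᵐᵒᵖ Γ] [SMulCommClass A Aᵐᵒᵖ Γ]
  [StarAddMonoid Γ] [StarModule ℂ Γ]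
  [Ring V] [Algebra ℂ V] [StarRing V] [StarModule ℂ V]
  [Ring B] [Algebra ℂ B] [StarRing B] [StarModule ℂ B]
  {C : BicovariantCalculus A Γ} {P : QuantumPrincipalBundle A V B}
  [Ring Ω] [Algebra ℂ Ω] [StarAddMonoid Ω] [StarModule ℂ Ω] {X : BundleCalculus C P Ω}
  {δ : EmbeddedDifferential C} {ω τ φ : C.inv →ₗ[ℂ] Ω}

variable (X δ) in
/-- The derivative `d φ - ⟨ω, φ⟩ - ⟨φ, ω⟩` of the curvature at `ω` in the direction `φ`. -/
def curvatureVariation (ω φ : C.inv →ₗ[ℂ] Ω) : C.inv →ₗ[ℂ] Ω :=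
  X.gd.d ∘ₗ φ - (bracket δ φ ω + bracket δ ω φ)

lemma IsPseudotensorial.d_sub_curvatureVariation_mem (hφ : X.IsPseudotensorial 1 φ) (ϑ : C.inv) :
    X.gd.d (φ ϑ) - X.curvatureVariation δ ω φ ϑ ∈ X.idealK δ ω := by
  have hbracket := hφ.bracket_sub_mem (δ := δ) (ω := ω) ϑ
  rw [pow_one, neg_one_smul, sub_neg_eq_add] at hbracket
  simpa only [curvatureVariation, LinearMap.sub_apply, LinearMap.add_apply, LinearMap.comp_apply,
    sub_sub_cancel, add_comm] using hbracket

variable (X δ) in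
/-- The curvature `R_{ω + z φ}`, as a polynomial in `z`. -/
def curvaturePoly (ω φ : C.inv →ₗ[ℂ] Ω) : C.inv →ₗ[ℂ] Polynomial Ω :=
  linearPath (X.gd.d ∘ₗ ω) (X.gd.d ∘ₗ φ) - bracket δ (linearPath ω φ) (linearPath ω φ)

lemma evalScalar_comp_curvaturePoly (z : ℂ) :
    (evalScalar z).toLinearMap ∘ₗ X.curvaturePoly δ ω φ = X.curvature δ (ω + z • φ) := by
  rw [curvaturePoly, LinearMap.comp_sub, algHom_comp_bracket, evalScalar_comp_linearPath,
    evalScalar_comp_linearPath, curvature, LinearMap.comp_add, LinearMap.comp_smul]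

lemma evalScalar_comp_derivative_comp_curvaturePoly (z : ℂ) :
    (evalScalar z).toLinearMap ∘ₗ derivative.restrictScalars ℂ ∘ₗ X.curvaturePoly δ ω φ =
      X.curvatureVariation δ (ω + z • φ) φ := by
  have hconst (f : C.inv →ₗ[ℂ] Ω) :
      (evalScalar z).toLinearMap ∘ₗ (monomial 0).restrictScalars ℂ ∘ₗ f = f := by ext; simp
  have hderivative : derivative.restrictScalars ℂ ∘ₗ bracket δ (linearPath ω φ) (linearPath ω φ) =
      bracket δ ((monomial 0).restrictScalars ℂ ∘ₗ φ) (linearPath ω φ) +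
        bracket δ (linearPath ω φ) ((monomial 0).restrictScalars ℂ ∘ₗ φ) := by
    rw [← derivative_comp_linearPath ω φ]
    exact congrArg (· ∘ₗ δ.δ) (derivative_comp_mul'_comp_map (linearPath ω φ) (linearPath ω φ))
  rw [curvaturePoly, LinearMap.comp_sub, derivative_comp_linearPath, hderivative,
    LinearMap.comp_sub, LinearMap.comp_add, algHom_comp_bracket, algHom_comp_bracket, hconst,
    hconst, evalScalar_comp_linearPath, curvatureVariation]

lemma evalScalar_lift_curvaturePoly (z : ℂ) (x : TensorAlgebra ℂ C.inv) :
    evalScalar z (TensorAlgebra.lift ℂ (X.curvaturePoly δ ω φ) x) =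
      X.weilForm δ (ω + z • φ) x := by
  rw [algHom_lift_apply, evalScalar_comp_curvaturePoly, weilForm]

lemma evalScalar_derivative_lift_curvaturePoly (z : ℂ) (x : TensorAlgebra ℂ C.inv) :
    evalScalar z (derivative (TensorAlgebra.lift ℂ (X.curvaturePoly δ ω φ) x)) =
      derivationAlong (X.curvature δ (ω + z • φ)) (X.curvatureVariation δ (ω + z • φ) φ) x := by
  rw [← evalScalar_comp_curvaturePoly, ← evalScalar_comp_derivative_comp_curvaturePoly,
    ← algHom_comp_derivationAlong, ← derivative_comp_lift]
  rfl

variable (X δ) in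
/-- The Chern–Simons forms of the connections `ω + z φ`, as a polynomial in `z`: their differential
is the derivative of `z ↦ W^{ω + z φ}`. -/
def chernSimonsPoly (ω φ : C.inv →ₗ[ℂ] Ω) : TensorAlgebra ℂ C.inv →ₗ[ℂ] Polynomial Ω :=
  derivationAlong (X.curvaturePoly δ ω φ) ((monomial 0).restrictScalars ℂ ∘ₗ φ)

lemma evalScalar_chernSimonsPoly (z : ℂ) (x : TensorAlgebra ℂ C.inv) :
    evalScalar z (X.chernSimonsPoly δ ω φ x) =
      derivationAlong (X.curvature δ (ω + z • φ)) φ x := by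
  have hconst : (evalScalar z).toLinearMap ∘ₗ (monomial 0).restrictScalars ℂ ∘ₗ φ = φ := by
    ext; simp
  rw [← evalScalar_comp_curvaturePoly, chernSimonsPoly, ← AlgHom.toLinearMap_apply,
    ← LinearMap.comp_apply, algHom_comp_derivationAlong, hconst]

section RealLine

variable {x : TensorAlgebra ℂ C.inv}

lemma isTensorial_of_isConnection_add_smul (hconn : ∀ t : ℝ, X.IsConnection (ω + (t : ℂ) • φ)) :
    X.IsTensorial φ := by
  simpa using (hconn 1).isTensorial_sub (hconn 0)

lemma isPseudotensorial_of_isConnection_add_smul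
    (hconn : ∀ t : ℝ, X.IsConnection (ω + (t : ℂ) • φ)) : X.IsPseudotensorial 1 φ :=
  (isTensorial_of_isConnection_add_smul hconn).isPseudotensorial fun ϑ => by
    simpa using sub_mem ((hconn 1).deg_one ϑ) ((hconn 0).deg_one ϑ)

lemma coeff_lift_curvaturePoly_mem (hconn : ∀ t : ℝ, X.IsConnection (ω + (t : ℂ) • φ))
    (hx : x ∈ C.invariants) (n : ℕ) :
    (TensorAlgebra.lift ℂ (X.curvaturePoly δ ω φ) x).coeff n ∈
      Subalgebra.toSubmodule X.baseForms := by
  refine coeff_mem_of_forall_evalScalar_mem (T := Set.range ((↑) : ℝ → ℂ))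
    (Set.infinite_range_of_injective Complex.ofReal_injective) (Set.forall_mem_range.2 ?_) n
  intro t
  rw [evalScalar_lift_curvaturePoly]
  exact (hconn t).weilForm_mem_baseForms hx

lemma evalScalar_chernSimonsPoly_mem (hconn : ∀ t : ℝ, X.IsConnection (ω + (t : ℂ) • φ))
    (hx : x ∈ C.invariants) (t : ℝ) :
    evalScalar (t : ℂ) (X.chernSimonsPoly δ ω φ x) ∈ X.baseForms := by
  rw [evalScalar_chernSimonsPoly]
  exact mem_baseForms_of_action_eq ((hconn t).curvature_isTensorial.action_derivationAlong
    (isTensorial_of_isConnection_add_smul hconn)) hx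

lemma coeff_chernSimonsPoly_mem (hconn : ∀ t : ℝ, X.IsConnection (ω + (t : ℂ) • φ))
    (hx : x ∈ C.invariants) (n : ℕ) :
    (X.chernSimonsPoly δ ω φ x).coeff n ∈ Subalgebra.toSubmodule X.baseForms :=
  coeff_mem_of_forall_evalScalar_mem (T := Set.range ((↑) : ℝ → ℂ))
    (Set.infinite_range_of_injective Complex.ofReal_injective)
    (Set.forall_mem_range.2 (evalScalar_chernSimonsPoly_mem hconn hx)) n

lemma evalScalar_derivative_lift_curvaturePoly_eq_d
    (hconn : ∀ t : ℝ, X.IsConnection (ω + (t : ℂ) • φ))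
    (hsplit : ∀ t : ℝ, X.Splitting δ (ω + (t : ℂ) • φ)) (hx : x ∈ C.invariants) (t : ℝ) :
    evalScalar (t : ℂ) (derivative (TensorAlgebra.lift ℂ (X.curvaturePoly δ ω φ) x)) =
      X.gd.d (evalScalar (t : ℂ) (X.chernSimonsPoly δ ω φ x)) := by
  have hbase : X.gd.d (evalScalar (t : ℂ) (X.chernSimonsPoly δ ω φ x)) -
      evalScalar (t : ℂ) (derivative (TensorAlgebra.lift ℂ (X.curvaturePoly δ ω φ) x)) ∈
        X.baseForms :=
    sub_mem (X.d_mem_baseForms (evalScalar_chernSimonsPoly_mem hconn hx t))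
      (evalScalar_derivative_mem (coeff_lift_curvaturePoly_mem hconn hx) (t : ℂ))
  refine (sub_eq_zero.1 (hsplit t _ (baseForms_le_hor hbase) ?_)).symm
  rw [evalScalar_chernSimonsPoly, evalScalar_derivative_lift_curvaturePoly]
  exact X.gd.d_derivationAlong_sub_mem _ (hconn t).sgn_curvature (hconn t).d_curvature_mem
    (isPseudotensorial_of_isConnection_add_smul hconn).d_sub_curvatureVariation_mem x

theorem exists_transgression (hconn : ∀ t : ℝ, X.IsConnection (ω + (t : ℂ) • φ))
    (hsplit : ∀ t : ℝ, X.Splitting δ (ω + (t : ℂ) • φ)) (hx : x ∈ C.invariants) :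
    ∃ η ∈ X.baseForms, X.weilForm δ (ω + φ) x - X.weilForm δ ω x = X.gd.d η := by
  refine ⟨integralZeroOne ℂ (X.chernSimonsPoly δ ω φ x),
    integralZeroOne_mem_of_coeff_mem (coeff_chernSimonsPoly_mem hconn hx), ?_⟩
  rw [← evalScalar_one_sub_zero_eq_integralZeroOne (T := Set.range ((↑) : ℝ → ℂ))
    (Set.infinite_range_of_injective Complex.ofReal_injective) X.gd.d
    (Set.forall_mem_range.2 (evalScalar_derivative_lift_curvaturePoly_eq_d hconn hsplit hx)),
    evalScalar_lift_curvaturePoly, evalScalar_lift_curvaturePoly, one_smul, zero_smul, add_zero]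

variable {𝒳 : AffineSubspace ℝ (C.inv →ₗ[ℂ] Ω)}

theorem exists_weilForm_sub_eq_d_of_mem (hconn : ∀ σ ∈ 𝒳, X.IsConnection σ)
    (hsplit : ∀ σ ∈ 𝒳, X.Splitting δ σ) (hω : ω ∈ 𝒳) (hτ : τ ∈ 𝒳) (hx : x ∈ C.invariants) :
    ∃ η ∈ X.baseForms, X.weilForm δ ω x - X.weilForm δ τ x = X.gd.d η := by
  have hline (t : ℝ) : τ + (t : ℂ) • (ω - τ) ∈ 𝒳 := by
    have hmem := AffineMap.lineMap_mem t hτ hω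
    rwa [AffineMap.lineMap_apply_module', add_comm] at hmem
  have h := exists_transgression (fun t => hconn _ (hline t)) (fun t => hsplit _ (hline t)) hx
  rwa [add_sub_cancel] at h

end RealLine

end BundleCalculus

end

end QuantumBundle

theorem mainTheorem1 {A Γ V B Ω : Type*} [Ring A] [HopfAlgebra ℂ A] [StarRing A]
    [StarModule ℂ A] [HopfStarAlgebra A]
    [AddCommGroup Γ] [Module ℂ Γ] [Module A Γ] [Module Aᵐᵒᵖ Γ]
    [IsScalarTower ℂ A Γ] [IsScalarTower ℂ Aᵐᵒᵖ Γ] [SMulCommClass A Aᵐᵒᵖ Γ]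
    [StarAddMonoid Γ] [StarModule ℂ Γ]
    [Ring V] [Algebra ℂ V] [StarRing V] [StarModule ℂ V]
    [Ring B] [Algebra ℂ B] [StarRing B] [StarModule ℂ B]
    [Ring Ω] [Algebra ℂ Ω] [StarAddMonoid Ω] [StarModule ℂ Ω]
    (C : BicovariantCalculus A Γ) (P : QuantumPrincipalBundle A V B) (X : BundleCalculus C P Ω)
    (δ : EmbeddedDifferential C)
    (𝒳 : AffineSubspace ℝ (C.inv →ₗ[ℂ] Ω)) (hne : (𝒳 : Set (C.inv →ₗ[ℂ] Ω)).Nonempty)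
    (hconn : ∀ ω ∈ 𝒳, X.IsConnection ω) (hsplit : ∀ ω ∈ 𝒳, X.Splitting δ ω) :
    (∀ ω ∈ 𝒳, ∀ ϑ ∈ C.invariants,
      X.weilForm δ ω ϑ ∈ X.baseForms ∧ X.gd.d (X.weilForm δ ω ϑ) = 0) ∧
    (∀ ω ∈ 𝒳, ∀ τ ∈ 𝒳, ∀ ϑ ∈ C.invariants, ∃ η ∈ X.baseForms,
      X.weilForm δ ω ϑ - X.weilForm δ τ ϑ = X.gd.d η) ∧
    ∃ W : C.invariants →ₐ[ℂ] X.Cohomology,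
      (∀ ω ∈ 𝒳, ∀ ϑ : C.invariants, ∃ h : X.weilForm δ ω ϑ ∈ X.cocycles,
        W ϑ = X.cls ⟨X.weilForm δ ω ϑ, h⟩) ∧
      (∀ ϑ : C.invariants, ∃ h : tensorStar (ϑ : TensorAlgebra ℂ C.inv) ∈ C.invariants,
        W ⟨tensorStar (ϑ : TensorAlgebra ℂ C.inv), h⟩ = X.starH (W ϑ)) := by
  obtain ⟨ω₀, hω₀⟩ := hne
  refine ⟨fun ω hω ϑ hϑ => (hconn ω hω).weilForm_mem_cocycles (hsplit ω hω) hϑ,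
    fun ω hω τ hτ ϑ hϑ => BundleCalculus.exists_weilForm_sub_eq_d_of_mem hconn hsplit hω hτ hϑ,
    (hconn ω₀ hω₀).weilHom δ (hsplit ω₀ hω₀), fun ω hω ϑ => ?_, fun ϑ => ?_⟩
  · exact ⟨(hconn ω hω).weilForm_mem_cocycles (hsplit ω hω) ϑ.2, BundleCalculus.cls_eq_cls
      (BundleCalculus.exists_weilForm_sub_eq_d_of_mem hconn hsplit hω₀ hω ϑ.2)⟩
  · exact ⟨C.tensorStar_mem_invariants ϑ.2,
      (hconn ω₀ hω₀).weilHom_tensorStar (hsplit ω₀ hω₀) ϑ⟩
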